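/- Let $n\in\mathbb N$, let $a_i<b_i$ be real numbers for $1\le i\le n$, and let $\Omega=\prod_{i=1}^n(a_i,b_i)\subset\mathbb R^n$. All functions are real valued. Let $L_0$ be the subspace of those $v\in L_2(\Omega)$ such that, for every $1\le i\le n$, $$\int_{a_i}^{b_i} v(x_1,\dots,x_{i-1},\xi_i,x_{i+1},\dots,x_n)\,d\xi_i=0\quad\text{for a.e. }x\in\Omega,$$ equipped with the norm $\|\cdot\|_2$ of $L_2(\Omega)$. For $v\in L_2(\Omega)$ put $Tv=T_1\cdots T_n v$, where $$(T_iv)(x)=\int_{a_i}^{x_i}v(x_1,\dots,x_{i-1},\xi_i,x_{i+1},\dots,x_n)\,d\xi_i\quad\text{for a.e. }x\in\Omega .$$ Let $M^{n,2}(\Omega)$ be the space of all $u\in L_2(\Omega)$ such that for every multi-index $\alpha\in\{0,1\}^n$ the weak derivative $D^\alpha u$ exists and belongs to $L_2(\Omega)$, with the norm $\big(\sum_{\alpha\in\{0,1\}^n}\|D^\alpha u\|_2^2\big)^{1/2}$. Let $M^{n,2}_0(\Omega)$ be the closure of $C_0^\infty(\Omega)$ in $M^{n,2}(\Omega)$,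 and equip $M^{n,2}_0(\Omega)$ with $\|u;M^{n,2}_0\|=\|D^{(1,\dots,1)}u\|_2$. Then $\|\cdot\,;M^{n,2}_0\|$ is a norm on $M^{n,2}_0(\Omega)$, and the restriction of $T$ to $L_0$ is an isometric isomorphism (a linear, norm-preserving bijection) from $L_0$ onto $M^{n,2}_0(\Omega)$. Furthermore, the inverse of $T|_{L_0}\colon L_0\to M^{n,2}_0(\Omega)$ is the restriction of the weak mixed derivative $D^{(1,\dots,1)}$ to $M^{n,2}_0(\Omega)$. -/

import Mathlib

open MeasureTheory TopologicalSpace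
open scoped Distributions ContDiff

noncomputable section

namespace MixedSob

/-- The bounded open box `∏ i, (a i, b i)` in `ℝⁿ`. -/
def box {n : ℕ} (a b : Fin n → ℝ) : Opens (Fin n → ℝ) where
  carrier := Set.univ.pi fun i => Set.Ioo (a i) (b i)
  is_open' := isOpen_set_pi Set.finite_univ fun _ _ => isOpen_Ioo

/-- Lebesgue measure on the box. -/
def boxMeasure {n : ℕ} (a b : Fin n → ℝ) : Measure (Fin n → ℝ) :=
  (volume : Measure (Fin n → ℝ)).restrict (box a b : Set (Fin n → ℝ))

/-- The Hilbert space `L₂(Ω)` of real functions on the box `Ω`. -/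
abbrev L2 {n : ℕ} (a b : Fin n → ℝ) : Type := Lp ℝ 2 (boxMeasure a b)

/-! ### Integration in one variable and the subspace `L₀` -/

/-- `(T_i f)(x) = ∫_{a_i}^{x_i} f(x_1, …, ξ, …, x_n) dξ`, with `ξ` in the `i`-th place. -/
def primitive {n : ℕ} (a : Fin n → ℝ) (i : Fin n) (f : (Fin n → ℝ) → ℝ) : (Fin n → ℝ) → ℝ :=
  fun x => ∫ ξ in (a i)..(x i), f (Function.update x i ξ)

/-- `T = T_1 ∘ ⋯ ∘ T_n`: the iterated integral
`(T f)(x) = ∫_{a_1}^{x_1} ⋯ ∫_{a_n}^{x_n} f(ξ) dξ_n ⋯ dξ_1`. -/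
def iteratedPrimitive {n : ℕ} (a : Fin n → ℝ) (f : (Fin n → ℝ) → ℝ) : (Fin n → ℝ) → ℝ :=
  (List.finRange n).foldr (primitive a) f

/-- `(S_i f)(x) = ∫_{a_i}^{b_i} f(x_1, …, ξ, …, x_n) dξ`, with `ξ` in the `i`-th place. -/
def sliceIntegral {n : ℕ} (a b : Fin n → ℝ) (i : Fin n) (f : (Fin n → ℝ) → ℝ) :
    (Fin n → ℝ) → ℝ :=
  fun x => ∫ ξ in (a i)..(b i), f (Function.update x i ξ)

theorem boxMeasure_eq_pi {n : ℕ} (a b : Fin n → ℝ) :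
    boxMeasure a b =
      Measure.pi fun i => (volume : Measure ℝ).restrict (Set.Ioo (a i) (b i)) :=
  Measure.restrict_pi_pi (fun _ : Fin n => (volume : Measure ℝ)) fun i => Set.Ioo (a i) (b i)

instance {n : ℕ} (a b : Fin n → ℝ) : IsFiniteMeasure (boxMeasure a b) := by
  rw [boxMeasure_eq_pi]; infer_instance

theorem measurable_update_prod {n : ℕ} (i : Fin n) :
    Measurable (fun p : (Fin n → ℝ) × ℝ => Function.update p.1 i p.2) := by
  refine measurable_pi_lambda _ fun j => ?_
  by_cases h : j = i
  · subst h; simpa using measurable_snd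
  · have h' : Measurable fun p : (Fin n → ℝ) × ℝ => p.1 j :=
      (measurable_pi_apply j).comp measurable_fst
    simpa [h] using h'

theorem map_update_prod {n : ℕ} (a b : Fin n → ℝ) (i : Fin n) :
    ((boxMeasure a b).prod ((volume : Measure ℝ).restrict (Set.Ioo (a i) (b i)))).map
        (fun p => Function.update p.1 i p.2) =
      ((volume : Measure ℝ).restrict (Set.Ioo (a i) (b i)) Set.univ) • boxMeasure a b := by
  have hm := measurable_update_prod i
  refine Measure.ext_of_lintegral _ fun f hf => ?_
  rw [lintegral_map hf hm, lintegral_smul_measure,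
    lintegral_prod (fun p : (Fin n → ℝ) × ℝ => f (Function.update p.1 i p.2))
      (hf.comp hm).aemeasurable, boxMeasure_eq_pi]
  set μ : Fin n → Measure ℝ := fun i => (volume : Measure ℝ).restrict (Set.Ioo (a i) (b i))
  have h1 := lmarginal_erase' (μ := μ) f hf (Finset.mem_univ i)
  have hg : Measurable (fun x : Fin n → ℝ => ∫⁻ ξ, f (Function.update x i ξ) ∂μ i) :=
    (hf.comp hm).lintegral_prod_right'
  have h2 := lmarginal_erase (μ := μ) _ hg (Finset.mem_univ i)
  rw [lintegral_eq_lmarginal_univ (μ := μ) (a : Fin n → ℝ),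
    lintegral_eq_lmarginal_univ (μ := μ) (f := f) (a : Fin n → ℝ), h2, ← h1]
  simp only [lmarginal_univ, lintegral_const, smul_eq_mul]
  rw [mul_comm]

/-- A property that holds a.e. on the box holds a.e. on almost every line segment
parallel to the `i`-th axis. -/
theorem ae_slice {n : ℕ} {a b : Fin n → ℝ} (i : Fin n) {p : (Fin n → ℝ) → Prop}
    (hp : ∀ᵐ x ∂boxMeasure a b, p x) :
    ∀ᵐ x ∂boxMeasure a b, ∀ᵐ ξ ∂(volume : Measure ℝ).restrict (Set.Ioo (a i) (b i)),
      p (Function.update x i ξ) := by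
  apply Measure.ae_ae_of_ae_prod
    (p := fun q : (Fin n → ℝ) × ℝ => p (Function.update q.1 i q.2))
  refine ae_of_ae_map (measurable_update_prod i).aemeasurable ?_
  rw [map_update_prod]
  exact Measure.ae_smul_measure hp _

theorem integrable_slice {n : ℕ} {a b : Fin n → ℝ} (i : Fin n) {f : (Fin n → ℝ) → ℝ}
    (hf : Integrable f (boxMeasure a b)) :
    ∀ᵐ x ∂boxMeasure a b, Integrable (fun ξ => f (Function.update x i ξ))
      ((volume : Measure ℝ).restrict (Set.Ioo (a i) (b i))) := by
  have h : Integrable f (((boxMeasure a b).prod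
      ((volume : Measure ℝ).restrict (Set.Ioo (a i) (b i)))).map
        (fun p => Function.update p.1 i p.2)) := by
    rw [map_update_prod]
    exact hf.smul_measure (measure_ne_top _ _)
  exact (h.comp_measurable (measurable_update_prod i)).prod_right_ae

theorem L2.integrable {n : ℕ} {a b : Fin n → ℝ} (u : L2 a b) : Integrable u (boxMeasure a b) :=
  (Lp.memLp u).integrable (by norm_num)

theorem mem_box_ae {n : ℕ} (a b : Fin n → ℝ) : ∀ᵐ x ∂boxMeasure a b, x ∈ box a b :=
  ae_restrict_mem (box a b).isOpen.measurableSet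

theorem sliceIntegral_eq {n : ℕ} {a b : Fin n → ℝ} (i : Fin n) (f : (Fin n → ℝ) → ℝ)
    {x : Fin n → ℝ} (hx : x ∈ box a b) :
    sliceIntegral a b i f x = ∫ ξ in Set.Ioo (a i) (b i), f (Function.update x i ξ) := by
  have h : x i ∈ Set.Ioo (a i) (b i) := hx i (Set.mem_univ i)
  rw [sliceIntegral, intervalIntegral.integral_of_le (h.1.trans h.2).le,
    integral_Ioc_eq_integral_Ioo]

/-- `L₀`, the set of all `v ∈ L₂(Ω)` with `S_i v = 0` a.e. for every `i`. -/
def L0 {n : ℕ} (a b : Fin n → ℝ) : Submodule ℝ (L2 a b) where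
  carrier := {v | ∀ i, sliceIntegral a b i v =ᵐ[boxMeasure a b] 0}
  zero_mem' := by
    intro i
    filter_upwards [mem_box_ae a b, ae_slice i (Lp.coeFn_zero ℝ 2 (boxMeasure a b))]
      with x hx h0
    rw [sliceIntegral_eq i _ hx, integral_congr_ae h0]
    simp
  add_mem' := by
    intro v w hv hw i
    filter_upwards [mem_box_ae a b, ae_slice i (Lp.coeFn_add v w), hv i, hw i,
      integrable_slice i (L2.integrable v), integrable_slice i (L2.integrable w)]
      with x hx h hv hw iv iw
    rw [sliceIntegral_eq i _ hx] at hv hw ⊢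
    rw [integral_congr_ae h]
    simp only [Pi.add_apply]
    rw [integral_add iv iw, hv, hw]
    simp
  smul_mem' := by
    intro c v hv i
    filter_upwards [mem_box_ae a b, ae_slice i (Lp.coeFn_smul c v), hv i] with x hx h hv
    rw [sliceIntegral_eq i _ hx] at hv ⊢
    rw [integral_congr_ae h]
    simp only [Pi.smul_apply]
    rw [integral_smul, hv]
    simp

/-! ### Mixed weak derivatives

A multi-index with entries in `{0, 1}` is encoded by the set `S` of the places where it is `1`;
its absolute value is `S.card`, and `(1, …, 1)` is `Finset.univ`. -/

/-- The classical partial derivative `∂f/∂x_i`. -/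
def partialDeriv {n : ℕ} (i : Fin n) (f : (Fin n → ℝ) → ℝ) : (Fin n → ℝ) → ℝ :=
  fun x => fderiv ℝ f x (Pi.single i 1)

/-- The classical mixed derivative `D^S = ∏_{i ∈ S} ∂/∂x_i`, each variable being
differentiated at most once. -/
def mixedDeriv {n : ℕ} (S : Finset (Fin n)) (f : (Fin n → ℝ) → ℝ) : (Fin n → ℝ) → ℝ :=
  (S.sort (· ≤ ·)).foldr partialDeriv f

theorem mixedDeriv_contDiff_hasCompactSupport {n : ℕ} (S : Finset (Fin n))
    {f : (Fin n → ℝ) → ℝ} (hf : ContDiff ℝ ∞ f) (hc : HasCompactSupport f) :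
    ContDiff ℝ ∞ (mixedDeriv S f) ∧ HasCompactSupport (mixedDeriv S f) := by
  unfold mixedDeriv
  induction S.sort (· ≤ ·) with
  | nil => exact ⟨hf, hc⟩
  | cons i l ih =>
    simp only [List.foldr_cons]
    exact ⟨(ih.1.fderiv_right (m := ∞) (by simp)).clm_apply contDiff_const,
      ih.2.fderiv_apply (𝕜 := ℝ) _⟩

/-- `w` is the weak derivative `D^S u` on the box:
`∫_Ω u D^S φ dx = (-1)^{|S|} ∫_Ω w φ dx` for all `φ ∈ C₀^∞(Ω)`. -/
def HasWeakMixedDeriv {n : ℕ} {a b : Fin n → ℝ} (S : Finset (Fin n)) (u w : L2 a b) : Prop :=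
  ∀ φ : 𝓓(box a b, ℝ),
    ∫ x, u x * mixedDeriv S φ x ∂boxMeasure a b =
      (-1) ^ S.card * ∫ x, w x * φ x ∂boxMeasure a b

theorem integrable_mul_test {n : ℕ} {a b : Fin n → ℝ} (u : L2 a b) {f : (Fin n → ℝ) → ℝ}
    (hf : Continuous f) (hc : HasCompactSupport f) :
    Integrable (fun x => u x * f x) (boxMeasure a b) := by
  have h : MemLp f 2 (boxMeasure a b) := hf.memLp_of_hasCompactSupport hc
  exact (Lp.memLp u).integrable_mul h

theorem integrable_mul_mixedDeriv {n : ℕ} {a b : Fin n → ℝ} (u : L2 a b) (S : Finset (Fin n))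
    (φ : 𝓓(box a b, ℝ)) :
    Integrable (fun x => u x * mixedDeriv S φ x) (boxMeasure a b) :=
  have h := mixedDeriv_contDiff_hasCompactSupport S φ.contDiff φ.hasCompactSupport
  integrable_mul_test u h.1.continuous h.2

theorem integral_add_mul {n : ℕ} {a b : Fin n → ℝ} (u v : L2 a b) {f : (Fin n → ℝ) → ℝ}
    (hu : Integrable (fun x => u x * f x) (boxMeasure a b))
    (hv : Integrable (fun x => v x * f x) (boxMeasure a b)) :
    ∫ x, (u + v : L2 a b) x * f x ∂boxMeasure a b =
      (∫ x, u x * f x ∂boxMeasure a b) + ∫ x, v x * f x ∂boxMeasure a b := by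
  rw [← integral_add hu hv]
  refine integral_congr_ae ?_
  filter_upwards [Lp.coeFn_add u v] with x hx
  rw [hx, Pi.add_apply, add_mul]

theorem integral_smul_mul {n : ℕ} {a b : Fin n → ℝ} (c : ℝ) (u : L2 a b)
    (f : (Fin n → ℝ) → ℝ) :
    ∫ x, (c • u : L2 a b) x * f x ∂boxMeasure a b = c * ∫ x, u x * f x ∂boxMeasure a b := by
  rw [← integral_const_mul]
  refine integral_congr_ae ?_
  filter_upwards [Lp.coeFn_smul c u] with x hx
  rw [hx, Pi.smul_apply, smul_eq_mul, mul_assoc]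

theorem HasWeakMixedDeriv.add {n : ℕ} {a b : Fin n → ℝ} {S : Finset (Fin n)}
    {u w u' w' : L2 a b} (h : HasWeakMixedDeriv S u w) (h' : HasWeakMixedDeriv S u' w') :
    HasWeakMixedDeriv S (u + u') (w + w') := by
  intro φ
  rw [integral_add_mul _ _ (integrable_mul_mixedDeriv u S φ) (integrable_mul_mixedDeriv u' S φ),
    integral_add_mul _ _ (integrable_mul_test w φ.continuous φ.hasCompactSupport)
      (integrable_mul_test w' φ.continuous φ.hasCompactSupport), h φ, h' φ, mul_add]

theorem HasWeakMixedDeriv.smul {n : ℕ} {a b : Fin n → ℝ} {S : Finset (Fin n)}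
    {u w : L2 a b} (c : ℝ) (h : HasWeakMixedDeriv S u w) :
    HasWeakMixedDeriv S (c • u) (c • w) := by
  intro φ
  rw [integral_smul_mul, integral_smul_mul, h φ]
  ring

theorem HasWeakMixedDeriv.unique {n : ℕ} {a b : Fin n → ℝ} {S : Finset (Fin n)}
    {u w w' : L2 a b} (h : HasWeakMixedDeriv S u w) (h' : HasWeakMixedDeriv S u w') :
    w = w' := by
  have key : ∀ᵐ x ∂(volume : Measure (Fin n → ℝ)), x ∈ (box a b : Set (Fin n → ℝ)) →
      w x - w' x = 0 := by
    refine (box a b).isOpen.ae_eq_zero_of_integral_contDiff_smul_eq_zero ?_ ?_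
    · have hi : IntegrableOn (fun x => w x - w' x) (box a b : Set (Fin n → ℝ)) volume :=
        (L2.integrable w).sub (L2.integrable w')
      exact hi.locallyIntegrableOn
    · intro g hg hc hs
      have e1 := h ⟨g, hg, hc, hs⟩
      rw [h' ⟨g, hg, hc, hs⟩] at e1
      have e2 := mul_left_cancel₀ (pow_ne_zero _ (by norm_num)) e1
      have e3 : ∫ x, g x • (w x - w' x) ∂boxMeasure a b = 0 := by
        have : (fun x => g x • (w x - w' x)) = fun x => w x * g x - w' x * g x := by
          funext x; simp only [smul_eq_mul]; ring
        rw [this, integral_sub (integrable_mul_test w hg.continuous hc)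
          (integrable_mul_test w' hg.continuous hc)]
        exact sub_eq_zero.mpr e2.symm
      rw [← e3]
      refine (setIntegral_eq_integral_of_forall_compl_eq_zero fun x hx => ?_).symm
      have : x ∉ tsupport g := fun hx' => hx (hs hx')
      rw [image_eq_zero_of_notMem_tsupport this, zero_smul]
  refine Lp.ext ?_
  have := (ae_restrict_iff' (box a b).isOpen.measurableSet).2 key
  filter_upwards [this] with x hx
  exact sub_eq_zero.mp hx

/-! ### The spaces `M^{n,2}(Ω)` and `M₀^{n,2}(Ω)` -/

/-- `M^{n,2}(Ω)` as a subspace of `L₂(Ω)`: all mixed weak derivatives `D^S u` (each variable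
being differentiated at most once) exist and belong to `L₂(Ω)`. -/
def mixedSubmodule {n : ℕ} (a b : Fin n → ℝ) : Submodule ℝ (L2 a b) where
  carrier := {u | ∀ S : Finset (Fin n), ∃ w : L2 a b, HasWeakMixedDeriv S u w}
  zero_mem' := fun S => ⟨0, by
    intro φ
    have h1 := integral_smul_mul (a := a) (b := b) 0 0 (mixedDeriv S φ)
    have h2 := integral_smul_mul (a := a) (b := b) 0 0 φ
    rw [zero_smul, zero_mul] at h1 h2
    rw [h1, h2, mul_zero]⟩
  add_mem' := fun hu hv S =>
    ⟨_, (hu S).choose_spec.add (hv S).choose_spec⟩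
  smul_mem' := fun c _ hu S => ⟨_, (hu S).choose_spec.smul c⟩

/-- The space `M^{n,2}(Ω)`, as a type of its own since it does not carry the `L₂` norm. -/
def M {n : ℕ} (a b : Fin n → ℝ) : Type := mixedSubmodule a b

instance {n : ℕ} (a b : Fin n → ℝ) : AddCommGroup (M a b) :=
  inferInstanceAs (AddCommGroup (mixedSubmodule a b))

instance {n : ℕ} (a b : Fin n → ℝ) : Module ℝ (M a b) :=
  inferInstanceAs (Module ℝ (mixedSubmodule a b))

/-- The inclusion of `M^{n,2}(Ω)` into `L₂(Ω)`. -/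
def M.toL2 {n : ℕ} {a b : Fin n → ℝ} : M a b →ₗ[ℝ] L2 a b := (mixedSubmodule a b).subtype

/-- The weak derivative `D^S` on `M^{n,2}(Ω)`. -/
def weakDeriv {n : ℕ} {a b : Fin n → ℝ} (S : Finset (Fin n)) : M a b →ₗ[ℝ] L2 a b where
  toFun u := (u.2 S).choose
  map_add' u v := ((u + v).2 S).choose_spec.unique ((u.2 S).choose_spec.add (v.2 S).choose_spec)
  map_smul' c u := ((c • u).2 S).choose_spec.unique ((u.2 S).choose_spec.smul c)

theorem weakDeriv_spec {n : ℕ} {a b : Fin n → ℝ} (S : Finset (Fin n)) (u : M a b) :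
    HasWeakMixedDeriv S (M.toL2 u) (weakDeriv S u) :=
  (u.2 S).choose_spec

/-- All derivatives `D^S u` at once, in the `ℓ²`-sum of copies of `L₂(Ω)`. -/
def jet {n : ℕ} {a b : Fin n → ℝ} :
    M a b →ₗ[ℝ] PiLp 2 (fun _ : Finset (Fin n) => L2 a b) where
  toFun u := WithLp.toLp 2 fun S => weakDeriv S u
  map_add' u v := by ext1 S; simp
  map_smul' c u := by ext1 S; simp

theorem weakDeriv_empty {n : ℕ} {a b : Fin n → ℝ} (u : M a b) :
    weakDeriv ∅ u = M.toL2 u := by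
  refine (weakDeriv_spec ∅ u).unique ?_
  intro φ
  simp [mixedDeriv]

theorem jet_injective {n : ℕ} {a b : Fin n → ℝ} : Function.Injective (jet (a := a) (b := b)) := by
  intro u v h
  have h' : weakDeriv ∅ u = weakDeriv ∅ v :=
    congrFun (congrArg WithLp.ofLp h) ∅
  rw [weakDeriv_empty, weakDeriv_empty] at h'
  exact Subtype.ext h'

/-- The norm of `M^{n,2}(Ω)`: `‖u‖ = (∑_S ‖D^S u‖₂²)^{1/2}`, the sum being over all
multi-indices with entries in `{0, 1}`, the zero one included. -/
instance {n : ℕ} (a b : Fin n → ℝ) : NormedAddCommGroup (M a b) :=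
  NormedAddCommGroup.induced (M a b) _ (jet (a := a) (b := b)) jet_injective

instance {n : ℕ} (a b : Fin n → ℝ) : NormedSpace ℝ (M a b) :=
  NormedSpace.induced ℝ (M a b) _ (jet (a := a) (b := b))

theorem norm_M_eq {n : ℕ} {a b : Fin n → ℝ} (u : M a b) :
    ‖u‖ = Real.sqrt (∑ S : Finset (Fin n), ‖weakDeriv S u‖ ^ 2) :=
  PiLp.norm_eq_of_L2 (jet u)

/-- The elements of `M^{n,2}(Ω)` that are (a.e. equal to) functions of `C₀^∞(Ω)`. -/
def testSubmodule {n : ℕ} (a b : Fin n → ℝ) : Submodule ℝ (M a b) where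
  carrier := {u | ∃ φ : 𝓓(box a b, ℝ), M.toL2 u =ᵐ[boxMeasure a b] φ}
  zero_mem' := ⟨0, by
    rw [map_zero]
    filter_upwards [Lp.coeFn_zero ℝ 2 (boxMeasure a b)] with x hx
    rw [hx]; rfl⟩
  add_mem' := by
    rintro u v ⟨φ, hφ⟩ ⟨ψ, hψ⟩
    refine ⟨φ + ψ, ?_⟩
    rw [map_add]
    filter_upwards [Lp.coeFn_add (M.toL2 u) (M.toL2 v), hφ, hψ] with x hx h1 h2
    rw [hx, Pi.add_apply, h1, h2]; rfl
  smul_mem' := by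
    rintro c u ⟨φ, hφ⟩
    refine ⟨c • φ, ?_⟩
    rw [map_smul]
    filter_upwards [Lp.coeFn_smul c (M.toL2 u), hφ] with x hx h1
    rw [hx, Pi.smul_apply, h1]; rfl

/-- `M₀^{n,2}(Ω)` as a subspace of `M^{n,2}(Ω)`: the closure of `C₀^∞(Ω)` with respect to the
norm of `M^{n,2}(Ω)`. -/
def zeroSubmodule {n : ℕ} (a b : Fin n → ℝ) : Submodule ℝ (M a b) :=
  (testSubmodule a b).topologicalClosure

/-- The space `M₀^{n,2}(Ω)`, as a type of its own since it does not carry the norm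
of `M^{n,2}(Ω)`. -/
def M0 {n : ℕ} (a b : Fin n → ℝ) : Type := zeroSubmodule a b

instance {n : ℕ} (a b : Fin n → ℝ) : AddCommGroup (M0 a b) :=
  inferInstanceAs (AddCommGroup (zeroSubmodule a b))

instance {n : ℕ} (a b : Fin n → ℝ) : Module ℝ (M0 a b) :=
  inferInstanceAs (Module ℝ (zeroSubmodule a b))

/-- The inclusion of `M₀^{n,2}(Ω)` into `M^{n,2}(Ω)`. -/
def M0.toM {n : ℕ} {a b : Fin n → ℝ} : M0 a b →ₗ[ℝ] M a b := (zeroSubmodule a b).subtype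

/-- The inclusion of `M₀^{n,2}(Ω)` into `L₂(Ω)`. -/
def M0.toL2 {n : ℕ} {a b : Fin n → ℝ} : M0 a b →ₗ[ℝ] L2 a b := M.toL2 ∘ₗ M0.toM

/-- The weak derivative `D^{(1, …, 1)}` restricted to `M₀^{n,2}(Ω)`. -/
def fullDeriv {n : ℕ} {a b : Fin n → ℝ} : M0 a b →ₗ[ℝ] L2 a b :=
  weakDeriv Finset.univ ∘ₗ M0.toM

/-- `M₀^{n,2}(Ω)` carries `‖u‖ = ‖D^{(1, …, 1)} u‖₂`. Only the seminorm axioms are built into this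
instance; that `‖u‖ = 0` forces `u = 0` is not assumed. -/
instance {n : ℕ} (a b : Fin n → ℝ) : SeminormedAddCommGroup (M0 a b) :=
  SeminormedAddCommGroup.induced (M0 a b) _ (fullDeriv (a := a) (b := b))

instance {n : ℕ} (a b : Fin n → ℝ) : NormedSpace ℝ (M0 a b) :=
  NormedSpace.induced ℝ (M0 a b) _ (fullDeriv (a := a) (b := b))

theorem norm_M0_eq {n : ℕ} {a b : Fin n → ℝ} (u : M0 a b) : ‖u‖ = ‖fullDeriv u‖ := rfl

end MixedSob

end

/-! In one variable, a primitive that vanishes at the left end of an interval vanishes at the right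
end exactly when its integrand has mean zero. The statement on the box is the tensor version of this
fact. The integrations involved are compositions of integral operators with bounded kernels in
single coordinates, hence bounded on `L₂(Ω)`. Tensor products of one-variable test functions span a
dense subspace, so bounded operators may be compared on them (`L2.clm_ext`), where every identity
reduces to calculus in one variable.

In this way `D^S T v` is found to be `T v` with the integrations over the coordinates in `S` left
out (`hasWeakMixedDeriv_primitiveOp`). Hence `T` is continuous from `L₂(Ω)` to `M^{n,2}(Ω)`, and `D
T = 1` for `D = D^{(1, …, 1)}`, which is the isometry. For a test function `φ`, duality gives `T D φ
= φ` and `S_i D φ = 0`. Both are closed conditions, so they pass to the closure `M₀^{n,2}(Ω)`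
(`zeroSubmodule_spec`).

It remains to see that `T` maps `L₀` into `M₀^{n,2}(Ω)` (`primitiveLin_mem_zeroSubmodule`). Take
`ρ_i ∈ C₀^∞(a_i, b_i)` with integral one and let `P` be the product of the operators `1 - ρ_i S_i`.
It fixes `L₀`, and it sends tensor products of test functions to tensor products of test functions
with mean zero, whose primitives are again test functions. By density and continuity `T P` maps all
of `L₂(Ω)` into `M₀^{n,2}(Ω)`, and `T = T P` on `L₀`. Definiteness of the norm follows from `T D =
1`, without a separate Poincaré inequality. -/

noncomputable section

namespace MixedSob

/-! ### Integral operators in one coordinate -/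

/-- Lebesgue measure on the `i`-th side of the box. -/
abbrev sideMeasure {n : ℕ} (a b : Fin n → ℝ) (i : Fin n) : Measure ℝ :=
  (volume : Measure ℝ).restrict (Set.Ioo (a i) (b i))

/-- A jointly measurable and bounded integral kernel. -/
structure BoundedKernel where
  toFun : ℝ → ℝ → ℝ
  measurable : Measurable (Function.uncurry toFun)
  bound : ℝ
  norm_le : ∀ x ξ, ‖toFun x ξ‖ ≤ bound

/-- The transpose `(x, ξ) ↦ k (ξ, x)` of a kernel. -/
def BoundedKernel.transpose (k : BoundedKernel) : BoundedKernel where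
  toFun x ξ := k.toFun ξ x
  measurable := k.measurable.comp measurable_swap
  bound := k.bound
  norm_le x ξ := k.norm_le ξ x

theorem BoundedKernel.measurable_right (k : BoundedKernel) (x : ℝ) : Measurable (k.toFun x) :=
  k.measurable.comp measurable_prodMk_left

theorem BoundedKernel.bound_nonneg (k : BoundedKernel) : 0 ≤ k.bound :=
  (norm_nonneg _).trans (k.norm_le 0 0)

/-- `x ↦ ∫ k(x_i, ξ) f(x_1, …, ξ, …, x_n) dξ` over the `i`-th side of the box, with `ξ` in the
`i`-th place. -/
def kernelFun {n : ℕ} (a b : Fin n → ℝ) (i : Fin n) (k : BoundedKernel) (f : (Fin n → ℝ) → ℝ) :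
    (Fin n → ℝ) → ℝ :=
  fun x => ∫ ξ, k.toFun (x i) ξ * f (Function.update x i ξ) ∂sideMeasure a b i

theorem kernelFun_congr {n : ℕ} {a b : Fin n → ℝ} (i : Fin n) (k : BoundedKernel)
    {f g : (Fin n → ℝ) → ℝ} (h : f =ᵐ[boxMeasure a b] g) :
    kernelFun a b i k f =ᵐ[boxMeasure a b] kernelFun a b i k g := by
  filter_upwards [ae_slice i h] with x hx
  refine integral_congr_ae ?_
  filter_upwards [hx] with ξ hξ
  rw [hξ]

theorem stronglyMeasurable_kernelFun {n : ℕ} {a b : Fin n → ℝ} (i : Fin n) (k : BoundedKernel)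
    {f : (Fin n → ℝ) → ℝ} (hf : StronglyMeasurable f) :
    StronglyMeasurable (kernelFun a b i k f) := by
  have h0 : Measurable fun p : (Fin n → ℝ) × ℝ => (p.1 i, p.2) := by fun_prop
  have h1 : Measurable fun p : (Fin n → ℝ) × ℝ => k.toFun (p.1 i) p.2 := k.measurable.comp h0
  have h2 : Measurable fun p : (Fin n → ℝ) × ℝ => f (Function.update p.1 i p.2) :=
    hf.measurable.comp (measurable_update_prod i)
  exact (h1.mul h2).stronglyMeasurable.integral_prod_right

theorem eLpNorm_two_sq {α : Type*} [MeasurableSpace α] (μ : Measure α) (f : α → ℝ) :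
    eLpNorm f 2 μ ^ 2 = ∫⁻ x, ‖f x‖ₑ ^ 2 ∂μ := by
  have h := eLpNorm_nnreal_pow_eq_lintegral (μ := μ) (f := f) (p := 2) (by norm_num)
  simpa using h

/-- Bounding the kernel leaves the `L¹` norm of `f` on the slice, which Cauchy–Schwarz bounds by the
`L²` norm at the cost of a factor `|b_i - a_i|^{1/2}`. -/
theorem enorm_kernelFun_sq_le {n : ℕ} {a b : Fin n → ℝ} (i : Fin n) (k : BoundedKernel)
    {f : (Fin n → ℝ) → ℝ} (hf : StronglyMeasurable f) (x : Fin n → ℝ) :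
    ‖kernelFun a b i k f x‖ₑ ^ 2 ≤ (ENNReal.ofReal k.bound ^ 2 * sideMeasure a b i Set.univ) *
      ∫⁻ ξ, ‖f (Function.update x i ξ)‖ₑ ^ 2 ∂sideMeasure a b i := by
  have hm : Measurable fun ξ => f (Function.update x i ξ) :=
    hf.measurable.comp (measurable_update x)
  have h1 : ‖kernelFun a b i k f x‖ₑ ≤
      ENNReal.ofReal k.bound * eLpNorm (fun ξ => f (Function.update x i ξ)) 1
        (sideMeasure a b i) := by
    rw [eLpNorm_one_eq_lintegral_enorm, ← lintegral_const_mul _ hm.enorm]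
    refine (enorm_integral_le_lintegral_enorm _).trans (lintegral_mono fun ξ => ?_)
    rw [enorm_mul]
    gcongr
    rw [← ofReal_norm]
    exact ENNReal.ofReal_le_ofReal (k.norm_le _ _)
  have h2 := eLpNorm_le_eLpNorm_mul_rpow_measure_univ (p := 1) (q := 2) (by norm_num)
    (hm.aestronglyMeasurable (μ := sideMeasure a b i))
  have h3 : (sideMeasure a b i Set.univ ^ (1 / (1 : ENNReal).toReal - 1 / (2 : ENNReal).toReal)) ^ 2
      = sideMeasure a b i Set.univ := by
    rw [← ENNReal.rpow_natCast, ← ENNReal.rpow_mul]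
    norm_num
  calc ‖kernelFun a b i k f x‖ₑ ^ 2
      ≤ (ENNReal.ofReal k.bound * (eLpNorm (fun ξ => f (Function.update x i ξ)) 2
        (sideMeasure a b i) * sideMeasure a b i Set.univ ^
          (1 / (1 : ENNReal).toReal - 1 / (2 : ENNReal).toReal))) ^ 2 := by
        gcongr
        exact h1.trans (by gcongr)
    _ = _ := by
        rw [mul_pow, mul_pow, h3, eLpNorm_two_sq]
        ring

/-- The slice bound is integrated over the box. By `map_update_prod`, averaging over slices
reproduces the box measure up to the length of the side, which is the second of the two length
factors in the squared estimate. -/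
theorem eLpNorm_kernelFun_le {n : ℕ} {a b : Fin n → ℝ} (i : Fin n) (k : BoundedKernel)
    {f : (Fin n → ℝ) → ℝ} (hf : StronglyMeasurable f) :
    eLpNorm (kernelFun a b i k f) 2 (boxMeasure a b) ≤
      (ENNReal.ofReal k.bound * sideMeasure a b i Set.univ) * eLpNorm f 2 (boxMeasure a b) := by
  have hm : Measurable fun p : (Fin n → ℝ) × ℝ => ‖f (Function.update p.1 i p.2)‖ₑ ^ 2 :=
    (hf.measurable.comp (measurable_update_prod i)).enorm.pow_const 2
  rw [← ENNReal.pow_le_pow_left_iff two_ne_zero, mul_pow, eLpNorm_two_sq, eLpNorm_two_sq]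
  have h := map_update_prod a b i
  calc ∫⁻ x, ‖kernelFun a b i k f x‖ₑ ^ 2 ∂boxMeasure a b
      ≤ ∫⁻ x, (ENNReal.ofReal k.bound ^ 2 * sideMeasure a b i Set.univ) *
          ∫⁻ ξ, ‖f (Function.update x i ξ)‖ₑ ^ 2 ∂sideMeasure a b i ∂boxMeasure a b :=
        lintegral_mono fun x => enorm_kernelFun_sq_le i k hf x
    _ = (ENNReal.ofReal k.bound ^ 2 * sideMeasure a b i Set.univ) *
          ∫⁻ x, ‖f x‖ₑ ^ 2 ∂(((boxMeasure a b).prod (sideMeasure a b i)).map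
            (fun p => Function.update p.1 i p.2)) := by
        rw [lintegral_const_mul _ (Measurable.lintegral_prod_right' hm),
          lintegral_map (hf.measurable.enorm.pow_const 2) (measurable_update_prod i),
          lintegral_prod _ hm.aemeasurable]
    _ ≤ _ := le_of_eq <| by
        rw [h, lintegral_smul_measure, smul_eq_mul]
        ring

theorem memLp_kernelFun {n : ℕ} {a b : Fin n → ℝ} (i : Fin n) (k : BoundedKernel)
    {f : (Fin n → ℝ) → ℝ} (hf : MemLp f 2 (boxMeasure a b)) :
    MemLp (kernelFun a b i k f) 2 (boxMeasure a b) := by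
  obtain ⟨g, hg, hfg⟩ := hf.1
  refine MemLp.ae_eq (kernelFun_congr i k hfg.symm)
    ⟨(stronglyMeasurable_kernelFun i k hg).aestronglyMeasurable, ?_⟩
  refine (eLpNorm_kernelFun_le i k hg).trans_lt ?_
  exact ENNReal.mul_lt_top (ENNReal.mul_lt_top ENNReal.ofReal_lt_top (measure_lt_top _ _))
    (eLpNorm_congr_ae hfg ▸ hf.2)

theorem BoundedKernel.integrable_mul (k : BoundedKernel) (t : ℝ) {μ : Measure ℝ} {f : ℝ → ℝ}
    (hf : Integrable f μ) : Integrable (fun ξ => k.toFun t ξ * f ξ) μ :=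
  hf.bdd_mul (k.measurable_right t).aestronglyMeasurable (ae_of_all _ fun ξ => k.norm_le t ξ)

/-- The bounded operator on `L₂(Ω)` given by an integral kernel in the `i`-th coordinate. -/
def kernelOp {n : ℕ} (a b : Fin n → ℝ) (i : Fin n) (k : BoundedKernel) : L2 a b →L[ℝ] L2 a b :=
  LinearMap.mkContinuous
    { toFun := fun v => (memLp_kernelFun i k (Lp.memLp v)).toLp _
      map_add' := by
        intro v w
        rw [← MemLp.toLp_add, MemLp.toLp_eq_toLp_iff]
        filter_upwards [kernelFun_congr i k (Lp.coeFn_add v w),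
          integrable_slice i (L2.integrable v), integrable_slice i (L2.integrable w)]
          with x hx iv iw
        rw [hx, Pi.add_apply, kernelFun, kernelFun, kernelFun,
          ← integral_add (k.integrable_mul _ iv) (k.integrable_mul _ iw)]
        simp only [Pi.add_apply, mul_add]
      map_smul' := by
        intro c v
        rw [RingHom.id_apply, ← MemLp.toLp_const_smul, MemLp.toLp_eq_toLp_iff]
        filter_upwards [kernelFun_congr i k (Lp.coeFn_smul c v)] with x hx
        rw [hx, Pi.smul_apply, kernelFun, kernelFun, ← integral_smul]
        refine integral_congr_ae (ae_of_all _ fun ξ => ?_)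
        simp only [Pi.smul_apply, smul_eq_mul]
        ring }
    (k.bound * (sideMeasure a b i Set.univ).toReal) (by
      intro v
      rw [LinearMap.coe_mk, AddHom.coe_mk, Lp.norm_toLp, Lp.norm_def]
      have h := eLpNorm_kernelFun_le (a := a) (b := b) i k (Lp.stronglyMeasurable v)
      have h' := ENNReal.toReal_mono (ENNReal.mul_ne_top
        (ENNReal.mul_ne_top ENNReal.ofReal_ne_top (measure_ne_top _ _)) (Lp.eLpNorm_ne_top v)) h
      rwa [ENNReal.toReal_mul, ENNReal.toReal_mul, ENNReal.toReal_ofReal k.bound_nonneg] at h')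

/-- The representative `f` is arbitrary, so that iterated operators can be followed through explicit
pointwise formulas. -/
theorem kernelOp_coeFn {n : ℕ} {a b : Fin n → ℝ} (i : Fin n) (k : BoundedKernel) {v : L2 a b}
    {f : (Fin n → ℝ) → ℝ} (hf : v =ᵐ[boxMeasure a b] f) :
    kernelOp a b i k v =ᵐ[boxMeasure a b] kernelFun a b i k f :=
  (MemLp.coeFn_toLp (memLp_kernelFun i k (Lp.memLp v))).trans (kernelFun_congr i k hf)

/-! ### Tensor products of functions of one variable -/

/-- The tensor product `x ↦ ∏ j, h_j (x_j)`. -/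
def tensFun {n : ℕ} (h : Fin n → ℝ → ℝ) : (Fin n → ℝ) → ℝ := fun x => ∏ j, h j (x j)

theorem memLp_tensFun {n : ℕ} {a b : Fin n → ℝ} {h : Fin n → ℝ → ℝ}
    (hh : ∀ j, MemLp (h j) 2 (sideMeasure a b j)) : MemLp (tensFun h) 2 (boxMeasure a b) := by
  rw [boxMeasure_eq_pi]
  have hm : AEStronglyMeasurable (tensFun h) (Measure.pi (sideMeasure a b)) :=
    Finset.aestronglyMeasurable_fun_prod _ fun j _ =>
      (hh j).1.comp_quasiMeasurePreserving (Measure.quasiMeasurePreserving_eval _ j)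
  rw [memLp_two_iff_integrable_sq hm]
  simp only [tensFun, ← Finset.prod_pow]
  exact Integrable.fintype_prod_dep (f := fun j t => h j t ^ 2) fun j => (hh j).integrable_sq

/-- The tensor product of square integrable functions, as an element of `L₂(Ω)`. -/
def tens {n : ℕ} {a b : Fin n → ℝ} (h : Fin n → ℝ → ℝ)
    (hh : ∀ j, MemLp (h j) 2 (sideMeasure a b j)) : L2 a b :=
  (memLp_tensFun hh).toLp _

theorem tens_coeFn {n : ℕ} {a b : Fin n → ℝ} {h : Fin n → ℝ → ℝ}
    (hh : ∀ j, MemLp (h j) 2 (sideMeasure a b j)) :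
    tens h hh =ᵐ[boxMeasure a b] tensFun h :=
  MemLp.coeFn_toLp _

theorem tens_congr {n : ℕ} {a b : Fin n → ℝ} {h g : Fin n → ℝ → ℝ}
    (hh : ∀ j, MemLp (h j) 2 (sideMeasure a b j)) (hg : h = g) :
    tens h hh = tens g (hg ▸ hh) := by
  subst hg; rfl

theorem inner_L2 {n : ℕ} {a b : Fin n → ℝ} {v w : L2 a b} {f g : (Fin n → ℝ) → ℝ}
    (hf : v =ᵐ[boxMeasure a b] f) (hg : w =ᵐ[boxMeasure a b] g) :
    inner ℝ v w = ∫ x, f x * g x ∂boxMeasure a b := by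
  rw [L2.inner_def]
  refine integral_congr_ae ?_
  filter_upwards [hf, hg] with x h1 h2
  rw [h1, h2]
  simp [mul_comm]

theorem inner_tens {n : ℕ} {a b : Fin n → ℝ} {h g : Fin n → ℝ → ℝ}
    (hh : ∀ j, MemLp (h j) 2 (sideMeasure a b j)) (hg : ∀ j, MemLp (g j) 2 (sideMeasure a b j)) :
    inner ℝ (tens h hh) (tens g hg) = ∏ j, ∫ t, h j t * g j t ∂sideMeasure a b j := by
  rw [inner_L2 (tens_coeFn hh) (tens_coeFn hg), boxMeasure_eq_pi,
    ← integral_fintype_prod_eq_prod (fun j t => h j t * g j t)]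
  simp only [tensFun, Finset.prod_mul_distrib]

/-- The operator with kernel `k` in one variable. -/
def kernelFun₁ {n : ℕ} (a b : Fin n → ℝ) (i : Fin n) (k : BoundedKernel) (g : ℝ → ℝ) : ℝ → ℝ :=
  fun t => ∫ ξ, k.toFun t ξ * g ξ ∂sideMeasure a b i

theorem kernelFun_tensFun {n : ℕ} {a b : Fin n → ℝ} (i : Fin n) (k : BoundedKernel)
    (h : Fin n → ℝ → ℝ) :
    kernelFun a b i k (tensFun h) =
      tensFun (Function.update h i (kernelFun₁ a b i k (h i))) := by
  funext x
  have h1 : ∀ ξ, tensFun h (Function.update x i ξ) =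
      h i ξ * ∏ j ∈ Finset.univ.erase i, h j (x j) := by
    intro ξ
    rw [tensFun, ← Finset.mul_prod_erase _ _ (Finset.mem_univ i), Function.update_self]
    congr 1
    refine Finset.prod_congr rfl fun j hj => ?_
    rw [Function.update_of_ne (Finset.ne_of_mem_erase hj)]
  rw [kernelFun, tensFun, ← Finset.mul_prod_erase _ _ (Finset.mem_univ i), Function.update_self,
    kernelFun₁, ← integral_mul_const]
  have h2 : ∏ j ∈ Finset.univ.erase i,
      Function.update h i (kernelFun₁ a b i k (h i)) j (x j) =
        ∏ j ∈ Finset.univ.erase i, h j (x j) :=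
    Finset.prod_congr rfl fun j hj => by
      rw [Function.update_of_ne (Finset.ne_of_mem_erase hj)]
  simp only [h1, ← mul_assoc]
  rw [← h2]

theorem memLp_kernelFun₁ {n : ℕ} {a b : Fin n → ℝ} {i : Fin n} (k : BoundedKernel) {g : ℝ → ℝ}
    (hg : MemLp g 2 (sideMeasure a b i)) :
    MemLp (kernelFun₁ a b i k g) 2 (sideMeasure a b i) := by
  obtain ⟨g', hg', hgg⟩ := hg.1
  have e : kernelFun₁ a b i k g = kernelFun₁ a b i k g' := by
    funext t
    refine integral_congr_ae ?_
    filter_upwards [hgg] with ξ h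
    rw [h]
  have hi : Integrable g' (sideMeasure a b i) :=
    (hg.integrable (by norm_num)).congr hgg
  rw [e]
  -- With a bounded kernel, the image of an integrable function is even bounded.
  refine MemLp.of_bound (C := k.bound * ∫ ξ, ‖g' ξ‖ ∂sideMeasure a b i) ?_ (ae_of_all _ fun t => ?_)
  · exact ((k.measurable.mul (hg'.measurable.comp
      measurable_snd)).stronglyMeasurable.integral_prod_right
        (f := fun t ξ => k.toFun t ξ * g' ξ)).aestronglyMeasurable
  · rw [← integral_const_mul]
    refine norm_integral_le_of_norm_le (hi.norm.const_mul _) (ae_of_all _ fun ξ => ?_)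
    rw [norm_mul]
    exact mul_le_mul_of_nonneg_right (k.norm_le _ _) (norm_nonneg _)

theorem memLp_update {n : ℕ} {a b : Fin n → ℝ} {h : Fin n → ℝ → ℝ} {i : Fin n} {g : ℝ → ℝ}
    (hh : ∀ j, MemLp (h j) 2 (sideMeasure a b j)) (hg : MemLp g 2 (sideMeasure a b i)) (j : Fin n) :
    MemLp (Function.update h i g j) 2 (sideMeasure a b j) := by
  by_cases hj : j = i
  · subst hj; rwa [Function.update_self]
  · rw [Function.update_of_ne hj]; exact hh j

theorem kernelOp_tens {n : ℕ} {a b : Fin n → ℝ} (i : Fin n) (k : BoundedKernel)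
    {h : Fin n → ℝ → ℝ} (hh : ∀ j, MemLp (h j) 2 (sideMeasure a b j)) :
    kernelOp a b i k (tens h hh) = tens (Function.update h i (kernelFun₁ a b i k (h i)))
      (memLp_update hh (memLp_kernelFun₁ k (hh i))) := by
  refine Lp.ext ((kernelOp_coeFn i k (tens_coeFn hh)).trans ?_)
  rw [kernelFun_tensFun]
  exact (tens_coeFn _).symm

/-! ### Density of tensor products of test functions -/

/-- `g ∈ C₀^∞(α, β)`. -/
structure IsTest (α β : ℝ) (g : ℝ → ℝ) : Prop where
  contDiff : ContDiff ℝ ∞ g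
  hasCompactSupport : HasCompactSupport g
  tsupport_subset : tsupport g ⊆ Set.Ioo α β

theorem memLp_of_continuous {n : ℕ} {a b : Fin n → ℝ} {i : Fin n} {g : ℝ → ℝ}
    (hg : Continuous g) : MemLp g 2 (sideMeasure a b i) := by
  obtain ⟨C, hC⟩ := isCompact_Icc.exists_bound_of_continuousOn
    (hg.continuousOn (s := Set.Icc (a i) (b i)))
  refine MemLp.of_bound hg.aestronglyMeasurable C ?_
  filter_upwards [ae_restrict_mem measurableSet_Ioo] with t ht
  exact hC t (Set.Ioo_subset_Icc_self ht)

theorem IsTest.memLp {n : ℕ} {a b : Fin n → ℝ} {h : Fin n → ℝ → ℝ}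
    (hh : ∀ j, IsTest (a j) (b j) (h j)) (j : Fin n) : MemLp (h j) 2 (sideMeasure a b j) :=
  memLp_of_continuous (hh j).contDiff.continuous

/-- Test functions increasing to the indicator function of `(α, β)`. -/
def plateau (α β : ℝ) (k : ℕ) (x : ℝ) : ℝ :=
  Real.smoothTransition ((k + 1) * (x - α) - 1) * Real.smoothTransition ((k + 1) * (β - x) - 1)

theorem isTest_plateau (α β : ℝ) (k : ℕ) : IsTest α β (plateau α β k) := by
  have hk : (0 : ℝ) < k + 1 := by positivity
  -- Each factor vanishes within distance `1 / (k + 1)` of its endpoint. If `α ≥ β` the interval on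
  -- the right is empty, so no order of the endpoints is needed.
  have hsub : tsupport (plateau α β k) ⊆ Set.Icc (α + 1 / (k + 1)) (β - 1 / (k + 1)) := by
    refine closure_minimal (fun x hx => ?_) isClosed_Icc
    have h := mul_ne_zero_iff.1 (Function.mem_support.1 hx)
    constructor
    · by_contra hlt
      refine h.1 (Real.smoothTransition.zero_of_nonpos ?_)
      have : (k + 1) * (x - α) ≤ (k + 1) * (1 / (k + 1)) := by gcongr; linarith
      rw [mul_one_div_cancel hk.ne'] at this
      linarith
    · by_contra hlt
      refine h.2 (Real.smoothTransition.zero_of_nonpos ?_)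
      have : (k + 1) * (β - x) ≤ (k + 1) * (1 / (k + 1)) := by gcongr; linarith
      rw [mul_one_div_cancel hk.ne'] at this
      linarith
  have h1 : (0 : ℝ) < 1 / (k + 1) := by positivity
  refine ⟨?_, HasCompactSupport.of_support_subset_isCompact isCompact_Icc
    (subset_closure.trans hsub), hsub.trans fun x hx => ⟨by linarith [hx.1], by linarith [hx.2]⟩⟩
  refine (Real.smoothTransition.contDiff.comp ?_).mul (Real.smoothTransition.contDiff.comp ?_)
  · fun_prop
  · fun_prop

theorem abs_plateau_le (α β : ℝ) (k : ℕ) (x : ℝ) : |plateau α β k x| ≤ 1 := by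
  rw [plateau, abs_mul, abs_of_nonneg (Real.smoothTransition.nonneg _),
    abs_of_nonneg (Real.smoothTransition.nonneg _)]
  exact mul_le_one₀ (Real.smoothTransition.le_one _) (Real.smoothTransition.nonneg _)
    (Real.smoothTransition.le_one _)

theorem tendsto_plateau (α β x : ℝ) :
    Filter.Tendsto (fun k => plateau α β k x) Filter.atTop
      (nhds ((Set.Ioo α β).indicator 1 x)) := by
  by_cases hx : x ∈ Set.Ioo α β
  · rw [Set.indicator_of_mem hx]
    refine tendsto_const_nhds.congr' ?_
    have key : ∀ d : ℝ, 0 < d → ∀ᶠ k : ℕ in Filter.atTop, 1 ≤ ((k : ℝ) + 1) * d - 1 := by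
      intro d hd
      -- A factor equals one as soon as the distance to its endpoint is at least `2 / (k + 1)`.
      obtain ⟨N, hN⟩ := exists_nat_gt (2 / d)
      filter_upwards [Filter.eventually_ge_atTop N] with k hk
      have : (N : ℝ) ≤ k := by exact_mod_cast hk
      rw [div_lt_iff₀ hd] at hN
      nlinarith
    filter_upwards [key _ (sub_pos.2 hx.1), key _ (sub_pos.2 hx.2)] with k h1 h2
    rw [plateau, Real.smoothTransition.one_of_one_le h1, Real.smoothTransition.one_of_one_le h2]
    simp
  · rw [Set.indicator_of_notMem hx]
    refine tendsto_const_nhds.congr fun k => ?_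
    exact (image_eq_zero_of_notMem_tsupport
      fun h => hx ((isTest_plateau α β k).tsupport_subset h)).symm

theorem IsTest.mono {α β α' β' : ℝ} {g : ℝ → ℝ} (hg : IsTest α β g) (hα : α' ≤ α) (hβ : β ≤ β') :
    IsTest α' β' g :=
  ⟨hg.1, hg.2, hg.3.trans (Set.Ioo_subset_Ioo hα hβ)⟩

theorem prod_indicator_one {n : ℕ} (s : Fin n → Set ℝ) (x : Fin n → ℝ) :
    ∏ j, (s j).indicator (1 : ℝ → ℝ) (x j) = (Set.univ.pi s).indicator (1 : (Fin n → ℝ) → ℝ) x := by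
  by_cases hx : x ∈ Set.univ.pi s
  · rw [Set.indicator_of_mem hx]
    exact Finset.prod_eq_one fun j _ => Set.indicator_of_mem (hx j (Set.mem_univ j)) _
  · rw [Set.indicator_of_notMem hx]
    simp only [Set.mem_pi, Set.mem_univ, true_imp_iff, not_forall] at hx
    obtain ⟨j, hj⟩ := hx
    exact Finset.prod_eq_zero (Finset.mem_univ j) (Set.indicator_of_notMem hj _)

/-- Products of plateau functions converge boundedly to the indicator of a box, so dominated
convergence applies with majorant `|w|`. -/
theorem setIntegral_pi_Ioo_eq_zero {n : ℕ} {a b : Fin n → ℝ} {w : L2 a b}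
    (hw : ∀ h : Fin n → ℝ → ℝ, (∀ j, IsTest (a j) (b j) (h j)) →
      ∫ x, w x * tensFun h x ∂boxMeasure a b = 0) (c d : Fin n → ℝ) :
    ∫ x in Set.univ.pi (fun j => Set.Ioo (c j) (d j)), w x ∂boxMeasure a b = 0 := by
  -- The sides are cut down to those of `Ω`, so that the plateau functions are admissible in `hw`;
  -- almost everywhere on `Ω` this changes nothing.
  set s : Fin n → Set ℝ := fun j => Set.Ioo (max (a j) (c j)) (min (b j) (d j))
  have hs : MeasurableSet (Set.univ.pi s) := MeasurableSet.univ_pi fun j => measurableSet_Ioo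
  set F : ℕ → (Fin n → ℝ) → ℝ := fun k =>
    tensFun fun j => plateau (max (a j) (c j)) (min (b j) (d j)) k
  have hF : ∀ k, Continuous (F k) := fun k => continuous_finsetProd _ fun j _ =>
    (isTest_plateau _ _ _).contDiff.continuous.comp (continuous_apply j)
  have hlim : Filter.Tendsto (fun k => ∫ x, w x * F k x ∂boxMeasure a b) Filter.atTop
      (nhds (∫ x, w x * (Set.univ.pi s).indicator 1 x ∂boxMeasure a b)) := by
    refine tendsto_integral_of_dominated_convergence (fun x => |w x|)
      (fun k => (Lp.aestronglyMeasurable w).mul (hF k).aestronglyMeasurable)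
      (L2.integrable w).abs (fun k => ae_of_all _ fun x => ?_) (ae_of_all _ fun x => ?_)
    · rw [Real.norm_eq_abs, abs_mul]
      refine mul_le_of_le_one_right (abs_nonneg _) ?_
      simp only [F, tensFun, Finset.abs_prod]
      exact Finset.prod_le_one (fun j _ => abs_nonneg _) fun j _ => abs_plateau_le _ _ _ _
    · refine Filter.Tendsto.const_mul _ ?_
      rw [← prod_indicator_one]
      exact tendsto_finsetProd _ fun j _ => tendsto_plateau _ _ _
  have h0 : ∀ k, ∫ x, w x * F k x ∂boxMeasure a b = 0 := fun k =>
    hw _ fun j => (isTest_plateau _ _ k).mono (le_max_left _ _) (min_le_left _ _)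
  simp only [h0] at hlim
  rw [← integral_indicator (MeasurableSet.univ_pi fun j => measurableSet_Ioo),
    tendsto_nhds_unique tendsto_const_nhds hlim]
  refine integral_congr_ae ?_
  filter_upwards [mem_box_ae a b] with x hx
  have hiff : x ∈ Set.univ.pi (fun j => Set.Ioo (c j) (d j)) ↔ x ∈ Set.univ.pi s := by
    simp only [Set.mem_pi, Set.mem_univ, true_imp_iff, s]
    refine forall_congr' fun j => ?_
    have h : x j ∈ Set.Ioo (a j) (b j) := hx j (Set.mem_univ j)
    simp only [Set.mem_Ioo, max_lt_iff, lt_min_iff]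
    exact ⟨fun H => ⟨⟨h.1, H.1⟩, h.2, H.2⟩, fun H => ⟨H.1.2, H.2.2⟩⟩
  by_cases hx' : x ∈ Set.univ.pi s
  · rw [Set.indicator_of_mem hx', Set.indicator_of_mem (hiff.2 hx')]
    simp
  · rw [Set.indicator_of_notMem hx', Set.indicator_of_notMem (fun h => hx' (hiff.1 h))]
    simp

/-- Rational boxes form a π-system generating the Borel sets, so the vanishing of the integral of
`w` spreads from boxes to all measurable sets. -/
theorem eq_zero_of_integral_mul_tensFun {n : ℕ} {a b : Fin n → ℝ} {w : L2 a b}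
    (hw : ∀ h : Fin n → ℝ → ℝ, (∀ j, IsTest (a j) (b j) (h j)) →
      ∫ x, w x * tensFun h x ∂boxMeasure a b = 0) : w = 0 := by
  have hbox := setIntegral_pi_Ioo_eq_zero hw
  have hgen : (MeasurableSpace.pi : MeasurableSpace (Fin n → ℝ)) =
      MeasurableSpace.generateFrom (Set.univ.pi '' Set.univ.pi fun _ =>
        ⋃ (p : ℚ) (q : ℚ) (_ : p < q), {Set.Ioo (p : ℝ) (q : ℝ)}) := by
    refine (generateFrom_eq_pi (fun i => ?_) fun i => ?_).symm
    · rw [← Real.borel_eq_generateFrom_Ioo_rat, ← BorelSpace.measurable_eq]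
    · exact (Real.finiteSpanningSetsInIooRat volume).isCountablySpanning
  -- The total integral is needed for complements; it is the integral over the box `Ω` itself.
  have huniv : ∫ x, w x ∂boxMeasure a b = 0 := by
    rw [← hbox a b]
    refine (setIntegral_eq_integral_of_ae_compl_eq_zero ?_).symm
    filter_upwards [mem_box_ae a b] with x hx hx'
    exact absurd hx hx'
  have key : ∀ s : Set (Fin n → ℝ), MeasurableSet s → ∫ x in s, w x ∂boxMeasure a b = 0 := by
    refine MeasurableSpace.induction_on_inter hgen
      (IsPiSystem.pi fun _ => Real.isPiSystem_Ioo_rat) (by simp) ?_ ?_ ?_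
    · rintro - ⟨t, ht, rfl⟩
      simp only [Set.mem_pi, Set.mem_univ, true_imp_iff, Set.mem_iUnion, Set.mem_singleton_iff,
        exists_prop] at ht
      choose p q hpq ht using ht
      obtain rfl : t = fun j => Set.Ioo (p j : ℝ) (q j) := funext ht
      exact hbox _ _
    · intro t ht h
      have := integral_add_compl ht (L2.integrable w)
      rw [huniv, h, zero_add] at this
      exact this
    · intro f hd hm h
      rw [integral_iUnion hm hd (L2.integrable w).integrableOn]
      simp [h]
  refine Lp.ext (((L2.integrable w).ae_eq_zero_of_forall_setIntegral_eq_zero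
    fun s hs _ => key s hs).trans (Lp.coeFn_zero ℝ 2 (boxMeasure a b)).symm)

/-- Two elements of `L₂(Ω)` agree if they have the same inner products with all tensor products
of test functions. -/
theorem L2.ext_inner_tens {n : ℕ} {a b : Fin n → ℝ} {v w : L2 a b}
    (h : ∀ (g : Fin n → ℝ → ℝ) (hg : ∀ j, IsTest (a j) (b j) (g j)),
      inner ℝ v (tens g (IsTest.memLp hg)) = inner ℝ w (tens g (IsTest.memLp hg))) : v = w := by
  rw [← sub_eq_zero]
  refine eq_zero_of_integral_mul_tensFun fun g hg => ?_
  rw [← inner_L2 (Filter.EventuallyEq.refl _ _) (tens_coeFn (IsTest.memLp hg)), inner_sub_left,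
    h g hg, sub_self]

/-- The tensor products of test functions. -/
def testTensors {n : ℕ} (a b : Fin n → ℝ) : Set (L2 a b) :=
  {v | ∃ (g : Fin n → ℝ → ℝ) (hg : ∀ j, IsTest (a j) (b j) (g j)), v = tens g (IsTest.memLp hg)}

theorem dense_span_testTensors {n : ℕ} (a b : Fin n → ℝ) :
    Dense (Submodule.span ℝ (testTensors a b) : Set (L2 a b)) := by
  rw [Submodule.dense_iff_topologicalClosure_eq_top, Submodule.topologicalClosure_eq_top_iff,
    Submodule.eq_bot_iff]
  intro w hw
  refine L2.ext_inner_tens fun g hg => ?_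
  rw [inner_zero_left]
  exact (Submodule.mem_orthogonal' _ _).1 hw _ (Submodule.subset_span ⟨g, hg, rfl⟩)

/-- Bounded operators on `L₂(Ω)` are determined by their values on tensor products of test
functions. -/
theorem L2.clm_ext {n : ℕ} {a b : Fin n → ℝ} {Y : Type*} [NormedAddCommGroup Y] [NormedSpace ℝ Y]
    {A B : L2 a b →L[ℝ] Y}
    (h : ∀ (g : Fin n → ℝ → ℝ) (hg : ∀ j, IsTest (a j) (b j) (g j)),
      A (tens g (IsTest.memLp hg)) = B (tens g (IsTest.memLp hg))) : A = B := by
  refine ContinuousLinearMap.ext_on (dense_span_testTensors a b) ?_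
  rintro - ⟨g, hg, rfl⟩
  exact h g hg

/-! ### Compositions of operators in different coordinates -/

/-- The composition, along a list of coordinates, of the operators with kernels `κ i` in the
`i`-th coordinate. -/
def kernelOps {n : ℕ} (a b : Fin n → ℝ) (κ : Fin n → BoundedKernel) (l : List (Fin n)) :
    L2 a b →L[ℝ] L2 a b :=
  l.foldr (fun i A => kernelOp a b i (κ i) ∘L A) (ContinuousLinearMap.id ℝ _)

theorem kernelOps_cons {n : ℕ} {a b : Fin n → ℝ} (κ : Fin n → BoundedKernel) (i : Fin n)
    (l : List (Fin n)) (v : L2 a b) :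
    kernelOps a b κ (i :: l) v = kernelOp a b i (κ i) (kernelOps a b κ l v) := rfl

/-- The action of `kernelOps` on the factors of a tensor product. -/
def kernelFuns₁ {n : ℕ} (a b : Fin n → ℝ) (κ : Fin n → BoundedKernel) (l : List (Fin n))
    (h : Fin n → ℝ → ℝ) : Fin n → ℝ → ℝ :=
  fun j => if j ∈ l then kernelFun₁ a b j (κ j) (h j) else h j

theorem memLp_kernelFuns₁ {n : ℕ} {a b : Fin n → ℝ} (κ : Fin n → BoundedKernel)
    (l : List (Fin n)) {h : Fin n → ℝ → ℝ} (hh : ∀ j, MemLp (h j) 2 (sideMeasure a b j))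
    (j : Fin n) : MemLp (kernelFuns₁ a b κ l h j) 2 (sideMeasure a b j) := by
  unfold kernelFuns₁
  split_ifs
  · exact memLp_kernelFun₁ _ (hh j)
  · exact hh j

/-- Since `l` has no repetitions, each factor is acted on at most once, and the order of the list
becomes irrelevant. -/
theorem kernelOps_tens {n : ℕ} {a b : Fin n → ℝ} (κ : Fin n → BoundedKernel)
    {l : List (Fin n)} (hl : l.Nodup) {h : Fin n → ℝ → ℝ}
    (hh : ∀ j, MemLp (h j) 2 (sideMeasure a b j)) :
    kernelOps a b κ l (tens h hh) = tens (kernelFuns₁ a b κ l h) (memLp_kernelFuns₁ κ l hh) := by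
  induction l with
  | nil => exact tens_congr hh (by funext j; simp [kernelFuns₁])
  | cons i l ih =>
    obtain ⟨hi, hl⟩ := List.nodup_cons.1 hl
    rw [kernelOps_cons, ih hl, kernelOp_tens]
    refine tens_congr _ ?_
    funext j
    by_cases hj : j = i
    · subst hj
      simp [kernelFuns₁, hi]
    · simp [kernelFuns₁, hj]

/-- Fubini's theorem, the kernel being bounded and `g`, `h` integrable. -/
theorem integral_mul_kernelFun₁ {n : ℕ} {a b : Fin n → ℝ} {i : Fin n} (k : BoundedKernel)
    {g h : ℝ → ℝ} (hg : Integrable g (sideMeasure a b i)) (hh : Integrable h (sideMeasure a b i)) :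
    ∫ t, g t * kernelFun₁ a b i k h t ∂sideMeasure a b i =
      ∫ t, kernelFun₁ a b i k.transpose g t * h t ∂sideMeasure a b i := by
  simp only [kernelFun₁, ← integral_const_mul, ← integral_mul_const]
  rw [integral_integral_swap]
  · refine integral_congr_ae (ae_of_all _ fun t => integral_congr_ae (ae_of_all _ fun ξ => ?_))
    simp only [BoundedKernel.transpose]
    ring
  · have := (hg.mul_prod hh).bdd_mul (g := fun p : ℝ × ℝ => g p.1 * h p.2)
      (f := Function.uncurry k.toFun)
      k.measurable.aestronglyMeasurable (ae_of_all _ fun p => k.norm_le p.1 p.2)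
    refine this.congr (ae_of_all _ fun p => ?_)
    simp only [Function.uncurry]
    ring

/-- An adjoint reverses a composition, but on tensor products the order does not matter, so the same
list appears on both sides. -/
theorem adjoint_kernelOps {n : ℕ} (a b : Fin n → ℝ) (κ : Fin n → BoundedKernel)
    {l : List (Fin n)} (hl : l.Nodup) :
    ContinuousLinearMap.adjoint (kernelOps a b κ l) =
      kernelOps a b (fun i => (κ i).transpose) l := by
  refine L2.clm_ext fun g hg => L2.ext_inner_tens fun h hh => ?_
  have ig : ∀ j, Integrable (g j) (sideMeasure a b j) := fun j =>
    (IsTest.memLp hg j).integrable (by norm_num)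
  have ih : ∀ j, Integrable (h j) (sideMeasure a b j) := fun j =>
    (IsTest.memLp hh j).integrable (by norm_num)
  rw [ContinuousLinearMap.adjoint_inner_left, kernelOps_tens κ hl, kernelOps_tens _ hl,
    inner_tens, inner_tens]
  refine Finset.prod_congr rfl fun j _ => ?_
  unfold kernelFuns₁
  split_ifs
  · exact integral_mul_kernelFun₁ _ (ig j) (ih j)
  · rfl

theorem tens_congr_Ioo {n : ℕ} {a b : Fin n → ℝ} {h g : Fin n → ℝ → ℝ}
    (hh : ∀ j, MemLp (h j) 2 (sideMeasure a b j)) (hg : ∀ j, MemLp (g j) 2 (sideMeasure a b j))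
    (e : ∀ j, Set.EqOn (h j) (g j) (Set.Ioo (a j) (b j))) : tens h hh = tens g hg := by
  refine Lp.ext ((tens_coeFn hh).trans (Filter.EventuallyEq.trans ?_ (tens_coeFn hg).symm))
  filter_upwards [mem_box_ae a b] with x hx
  exact Finset.prod_congr rfl fun j _ => e j (hx j (Set.mem_univ j))

/-! ### The kernels of integration -/

/-- The kernel `1_{ξ < x}` of integration from the left end to `x`. -/
def leftKernel : BoundedKernel where
  toFun x ξ := if ξ < x then 1 else 0
  measurable := Measurable.ite (measurableSet_lt measurable_snd measurable_fst)
    measurable_const measurable_const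
  bound := 1
  norm_le x ξ := by split_ifs <;> simp

/-- The kernel `ρ(x)` of integration over the whole side, followed by multiplication by `ρ`. -/
def fullKernel (ρ : ℝ → ℝ) (hρ : Continuous ρ) (C : ℝ) (hC : ∀ x, ‖ρ x‖ ≤ C) :
    BoundedKernel where
  toFun x _ := ρ x
  measurable := hρ.measurable.comp measurable_fst
  bound := C
  norm_le x _ := hC x

/-- The kernel of integration over the whole side. -/
def oneKernel : BoundedKernel := fullKernel 1 continuous_const 1 (by simp)

theorem kernelFun₁_left {n : ℕ} {a b : Fin n → ℝ} {i : Fin n} (g : ℝ → ℝ) {t : ℝ}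
    (ht : t ∈ Set.Ioo (a i) (b i)) :
    kernelFun₁ a b i leftKernel g t = ∫ ξ in (a i)..t, g ξ := by
  have e : (fun ξ => leftKernel.toFun t ξ * g ξ) = (Set.Iio t).indicator g := by
    funext ξ
    by_cases h : ξ < t <;> simp [leftKernel, h]
  rw [kernelFun₁, e, integral_indicator measurableSet_Iio,
    Measure.restrict_restrict measurableSet_Iio, intervalIntegral.integral_of_le ht.1.le,
    integral_Ioc_eq_integral_Ioo]
  congr 2
  ext ξ
  simp only [Set.mem_inter_iff, Set.mem_Iio, Set.mem_Ioo]
  exact ⟨fun h => ⟨h.2.1, h.1⟩, fun h => ⟨h.2, h.1, h.2.trans ht.2⟩⟩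

theorem kernelFun₁_left_transpose {n : ℕ} {a b : Fin n → ℝ} {i : Fin n} (g : ℝ → ℝ) {t : ℝ}
    (ht : t ∈ Set.Ioo (a i) (b i)) :
    kernelFun₁ a b i leftKernel.transpose g t = ∫ ξ in t..(b i), g ξ := by
  have e : (fun ξ => leftKernel.transpose.toFun t ξ * g ξ) = (Set.Ioi t).indicator g := by
    funext ξ
    by_cases h : t < ξ <;> simp [leftKernel, BoundedKernel.transpose, h]
  rw [kernelFun₁, e, integral_indicator measurableSet_Ioi,
    Measure.restrict_restrict measurableSet_Ioi, intervalIntegral.integral_of_le ht.2.le,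
    integral_Ioc_eq_integral_Ioo]
  congr 2
  ext ξ
  simp only [Set.mem_inter_iff, Set.mem_Ioi, Set.mem_Ioo]
  exact ⟨fun h => ⟨h.1, h.2.2⟩, fun h => ⟨h.1, ht.1.trans h.1, h.2⟩⟩

/-- The operator `T`. -/
def primitiveOp {n : ℕ} (a b : Fin n → ℝ) : L2 a b →L[ℝ] L2 a b :=
  kernelOps a b (fun _ => leftKernel) (List.finRange n)

theorem primitiveOp_coeFn {n : ℕ} {a b : Fin n → ℝ} (v : L2 a b) {f : (Fin n → ℝ) → ℝ}
    (hf : f =ᵐ[boxMeasure a b] v) :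
    primitiveOp a b v =ᵐ[boxMeasure a b] iteratedPrimitive a f := by
  unfold primitiveOp iteratedPrimitive
  induction List.finRange n with
  | nil => exact hf.symm
  | cons i l ih =>
    rw [kernelOps_cons, List.foldr_cons]
    filter_upwards [kernelOp_coeFn i leftKernel ih, mem_box_ae a b] with x hx hb
    rw [hx]
    exact kernelFun₁_left (fun ξ => l.foldr (primitive a) f (Function.update x i ξ))
      (hb i (Set.mem_univ i))

/-- Rewrites membership in `L₀` as the vanishing of bounded operators, hence as a closed condition.
-/
theorem mem_L0_iff {n : ℕ} {a b : Fin n → ℝ} (v : L2 a b) :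
    v ∈ L0 a b ↔ ∀ i, kernelOp a b i oneKernel v = 0 := by
  refine forall_congr' fun i => ?_
  have h : kernelOp a b i oneKernel v =ᵐ[boxMeasure a b] sliceIntegral a b i v := by
    filter_upwards [kernelOp_coeFn i oneKernel (Filter.EventuallyEq.refl _ v), mem_box_ae a b]
      with x hx hb
    rw [hx, sliceIntegral_eq i _ hb]
    simp [kernelFun, oneKernel, fullKernel]
  rw [Lp.eq_zero_iff_ae_eq_zero]
  exact ⟨h.trans, h.symm.trans⟩

/-! ### Integration by parts -/

theorem contDiff_tensFun {n : ℕ} {h : Fin n → ℝ → ℝ} (hh : ∀ j, ContDiff ℝ ∞ (h j)) :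
    ContDiff ℝ ∞ (tensFun h) :=
  contDiff_prod fun j _ => (hh j).comp (contDiff_apply ℝ ℝ j)

theorem tensFun_update {n : ℕ} (h : Fin n → ℝ → ℝ) (i : Fin n) (g : ℝ → ℝ) (x : Fin n → ℝ)
    (t : ℝ) : tensFun (Function.update h i g) (Function.update x i t) =
      g t * ∏ j ∈ Finset.univ.erase i, h j (x j) := by
  rw [tensFun, ← Finset.mul_prod_erase _ _ (Finset.mem_univ i), Function.update_self,
    Function.update_self]
  congr 1
  refine Finset.prod_congr rfl fun j hj => ?_
  rw [Function.update_of_ne (Finset.ne_of_mem_erase hj),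
    Function.update_of_ne (Finset.ne_of_mem_erase hj)]

theorem partialDeriv_tensFun {n : ℕ} {h : Fin n → ℝ → ℝ} (hh : ∀ j, ContDiff ℝ ∞ (h j))
    (i : Fin n) : partialDeriv i (tensFun h) = tensFun (Function.update h i (deriv (h i))) := by
  funext x
  have h1 : HasDerivAt (fun t => tensFun h (Function.update x i t))
      (partialDeriv i (tensFun h) x) (x i) := by
    have hd := ((contDiff_tensFun hh).differentiable (by simp)
      (Function.update x i (x i))).hasFDerivAt.comp_hasDerivAt (x i) (hasDerivAt_update x i (x i))
    rwa [Function.update_eq_self] at hd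
  have h2 : HasDerivAt (fun t => tensFun h (Function.update x i t))
      (deriv (h i) (x i) * ∏ j ∈ Finset.univ.erase i, h j (x j)) (x i) := by
    have e : (fun t => tensFun h (Function.update x i t)) =
        fun t => h i t * ∏ j ∈ Finset.univ.erase i, h j (x j) := by
      funext t
      rw [← tensFun_update, Function.update_eq_self]
    rw [e]
    exact (((hh i).differentiable (by simp)) (x i)).hasDerivAt.mul_const _
  rw [h1.unique h2, ← tensFun_update, Function.update_eq_self]

theorem foldr_partialDeriv_contDiff {n : ℕ} (l : List (Fin n)) {f : (Fin n → ℝ) → ℝ}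
    (hf : ContDiff ℝ ∞ f) (hc : HasCompactSupport f) :
    ContDiff ℝ ∞ (l.foldr partialDeriv f) ∧ HasCompactSupport (l.foldr partialDeriv f) ∧
      tsupport (l.foldr partialDeriv f) ⊆ tsupport f := by
  induction l with
  | nil => exact ⟨hf, hc, subset_rfl⟩
  | cons i l ih =>
    refine ⟨(ih.1.fderiv_right (m := ∞) (by simp)).clm_apply contDiff_const,
      ih.2.1.fderiv_apply (𝕜 := ℝ) _, ?_⟩
    exact (tsupport_fderiv_apply_subset ℝ _).trans ih.2.2

/-- Integration by parts, one coordinate at a time. Only `f` has compact support; the factors `h j`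
need not vanish at the ends, which matters when they are primitives or constants. -/
theorem integral_tensFun_mul_foldr {n : ℕ} {l : List (Fin n)} (hl : l.Nodup)
    {h : Fin n → ℝ → ℝ} (hh : ∀ j, ContDiff ℝ ∞ (h j)) {f : (Fin n → ℝ) → ℝ}
    (hf : ContDiff ℝ ∞ f) (hc : HasCompactSupport f) :
    ∫ x, tensFun h x * l.foldr partialDeriv f x =
      (-1) ^ l.length * ∫ x, tensFun (fun j => if j ∈ l then deriv (h j) else h j) x * f x := by
  induction l generalizing h with
  | nil => simp
  | cons i l ih =>
    obtain ⟨hi, hl⟩ := List.nodup_cons.1 hl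
    obtain ⟨gs, gc, -⟩ := foldr_partialDeriv_contDiff l hf hc
    set g := l.foldr partialDeriv f
    have hh' : ∀ j, ContDiff ℝ ∞ (Function.update h i (deriv (h i)) j) := by
      intro j
      by_cases hj : j = i
      · subst hj
        rw [Function.update_self]
        exact (contDiff_infty_iff_deriv.1 (hh j)).2
      · rw [Function.update_of_ne hj]; exact hh j
    have hp : ∀ x, fderiv ℝ (tensFun h) x (Pi.single i 1) =
        tensFun (Function.update h i (deriv (h i))) x := fun x =>
      congrFun (partialDeriv_tensFun hh i) x
    have step : ∫ x, tensFun h x * partialDeriv i g x =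
        - ∫ x, tensFun (Function.update h i (deriv (h i))) x * g x := by
      have := integral_mul_fderiv_eq_neg_fderiv_mul_of_integrable (μ := volume)
        (f := tensFun h) (g := g) (v := Pi.single i 1) ?_ ?_ ?_
        (fun x _ => (contDiff_tensFun hh).differentiable (by simp) x)
        (fun x _ => gs.differentiable (by simp) x)
      · simp only [hp] at this
        exact this
      · simp only [hp]
        exact ((contDiff_tensFun hh').continuous.mul gs.continuous).integrable_of_hasCompactSupport
          gc.mul_left
      · exact ((contDiff_tensFun hh).continuous.mul ((gs.continuous_fderiv (by simp)).clm_apply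
          continuous_const)).integrable_of_hasCompactSupport (gc.fderiv_apply (𝕜 := ℝ) _).mul_left
      · exact ((contDiff_tensFun hh).continuous.mul gs.continuous).integrable_of_hasCompactSupport
          gc.mul_left
    rw [List.foldr_cons, step, ih hl hh', List.length_cons, pow_succ]
    have e : (fun j => if j ∈ l then deriv (Function.update h i (deriv (h i)) j)
        else Function.update h i (deriv (h i)) j) =
        fun j => if j ∈ i :: l then deriv (h j) else h j := by
      funext j
      by_cases hj : j = i
      · subst hj; simp [hi]
      · simp [hj]
    rw [e]
    ring

/-! ### Weak derivatives of `T v` -/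

theorem hasDerivAt_primitive {g : ℝ → ℝ} (hg : Continuous g) (α t : ℝ) :
    HasDerivAt (fun t => ∫ ξ in α..t, g ξ) (g t) t :=
  (hg.integral_hasStrictDerivAt α t).hasDerivAt

theorem contDiff_primitive {g : ℝ → ℝ} (hg : ContDiff ℝ ∞ g) (α : ℝ) :
    ContDiff ℝ ∞ fun t => ∫ ξ in α..t, g ξ := by
  have h := hasDerivAt_primitive hg.continuous α
  refine contDiff_infty_iff_deriv.2 ⟨fun t => (h t).differentiableAt, ?_⟩
  rwa [funext fun t => (h t).deriv]

theorem integral_box_mul {n : ℕ} {a b : Fin n → ℝ} (u : (Fin n → ℝ) → ℝ) {f : (Fin n → ℝ) → ℝ}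
    (hf : tsupport f ⊆ box a b) : ∫ x, u x * f x ∂boxMeasure a b = ∫ x, u x * f x :=
  setIntegral_eq_integral_of_forall_compl_eq_zero fun x hx => by
    rw [image_eq_zero_of_notMem_tsupport fun h => hx (hf h), mul_zero]

theorem integral_box_tensFun_mul_mixedDeriv {n : ℕ} {a b : Fin n → ℝ} (S : Finset (Fin n))
    {h : Fin n → ℝ → ℝ} (hh : ∀ j, ContDiff ℝ ∞ (h j)) (φ : 𝓓(box a b, ℝ)) :
    ∫ x, tensFun h x * mixedDeriv S φ x ∂boxMeasure a b =
      (-1) ^ S.card *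
        ∫ x, tensFun (fun j => if j ∈ S then deriv (h j) else h j) x * φ x ∂boxMeasure a b := by
  have hs : tsupport (mixedDeriv S φ) ⊆ tsupport φ :=
    (foldr_partialDeriv_contDiff (S.sort (· ≤ ·)) φ.contDiff φ.hasCompactSupport).2.2
  rw [integral_box_mul _ φ.tsupport_subset, integral_box_mul _ (hs.trans φ.tsupport_subset)]
  refine (integral_tensFun_mul_foldr (S.sort_nodup (· ≤ ·)) hh φ.contDiff
    φ.hasCompactSupport).trans ?_
  simp only [Finset.length_sort, Finset.mem_sort]

/-- The mixed derivative of a test function as an element of `L₂(Ω)`. -/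
def testDeriv {n : ℕ} {a b : Fin n → ℝ} (S : Finset (Fin n)) (φ : 𝓓(box a b, ℝ)) : L2 a b :=
  have h := mixedDeriv_contDiff_hasCompactSupport S φ.contDiff φ.hasCompactSupport
  MemLp.toLp (mixedDeriv S φ) (h.1.continuous.memLp_of_hasCompactSupport h.2)

theorem testDeriv_coeFn {n : ℕ} {a b : Fin n → ℝ} (S : Finset (Fin n)) (φ : 𝓓(box a b, ℝ)) :
    testDeriv S φ =ᵐ[boxMeasure a b] mixedDeriv S φ :=
  have h := mixedDeriv_contDiff_hasCompactSupport S φ.contDiff φ.hasCompactSupport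
  MemLp.coeFn_toLp (h.1.continuous.memLp_of_hasCompactSupport h.2)

theorem testDeriv_empty_coeFn {n : ℕ} {a b : Fin n → ℝ} (φ : 𝓓(box a b, ℝ)) :
    testDeriv ∅ φ =ᵐ[boxMeasure a b] φ := by
  have h := testDeriv_coeFn ∅ φ
  simpa [mixedDeriv] using h

/-- `T` without the integrations in the coordinates of `S`. -/
def partialPrimitiveOp {n : ℕ} (a b : Fin n → ℝ) (S : Finset (Fin n)) : L2 a b →L[ℝ] L2 a b :=
  kernelOps a b (fun _ => leftKernel) Sᶜ.toList

theorem partialPrimitiveOp_univ {n : ℕ} {a b : Fin n → ℝ} (v : L2 a b) :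
    partialPrimitiveOp a b Finset.univ v = v := by
  simp [partialPrimitiveOp, kernelOps]

theorem memLp_primitive {n : ℕ} {a b : Fin n → ℝ} {g : Fin n → ℝ → ℝ}
    (hg : ∀ j, ContDiff ℝ ∞ (g j)) (j : Fin n) :
    MemLp (fun t => ∫ ξ in (a j)..t, g j ξ) 2 (sideMeasure a b j) :=
  memLp_of_continuous (contDiff_primitive (hg j) _).continuous

theorem primitiveOp_tens {n : ℕ} {a b : Fin n → ℝ} {g : Fin n → ℝ → ℝ}
    (hg : ∀ j, ContDiff ℝ ∞ (g j)) :
    primitiveOp a b (tens g fun j => memLp_of_continuous (hg j).continuous) =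
      tens (fun j t => ∫ ξ in (a j)..t, g j ξ) (memLp_primitive hg) := by
  rw [primitiveOp, kernelOps_tens _ (List.nodup_finRange n)]
  refine tens_congr_Ioo _ _ fun j t ht => ?_
  simpa [kernelFuns₁] using kernelFun₁_left (g j) ht

theorem partialPrimitiveOp_tens {n : ℕ} {a b : Fin n → ℝ} {g : Fin n → ℝ → ℝ}
    (hg : ∀ j, ContDiff ℝ ∞ (g j)) (S : Finset (Fin n)) :
    partialPrimitiveOp a b S (tens g fun j => memLp_of_continuous (hg j).continuous)
      =ᵐ[boxMeasure a b]
        tensFun fun j => if j ∈ S then g j else fun t => ∫ ξ in (a j)..t, g j ξ := by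
  rw [partialPrimitiveOp, kernelOps_tens _ Sᶜ.nodup_toList]
  refine (tens_coeFn _).trans ?_
  filter_upwards [mem_box_ae a b] with x hx
  refine Finset.prod_congr rfl fun j _ => ?_
  by_cases hj : j ∈ S
  · simp [kernelFuns₁, hj]
  · simpa [kernelFuns₁, hj] using kernelFun₁_left (g j) (hx j (Set.mem_univ j))

/-- For fixed `φ` both sides of the defining identity are continuous functionals of `v`. On tensor
products of test functions the identity is integration by parts against the smooth primitives of the
factors. -/
theorem hasWeakMixedDeriv_primitiveOp {n : ℕ} {a b : Fin n → ℝ} (S : Finset (Fin n))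
    (v : L2 a b) : HasWeakMixedDeriv S (primitiveOp a b v) (partialPrimitiveOp a b S v) := by
  intro φ
  have key : innerSL ℝ (testDeriv S φ) ∘L primitiveOp a b =
      ((-1 : ℝ) ^ S.card) • (innerSL ℝ (testDeriv ∅ φ) ∘L partialPrimitiveOp a b S) := by
    refine L2.clm_ext fun g hg => ?_
    have hs : ∀ j, ContDiff ℝ ∞ (g j) := fun j => (hg j).contDiff
    simp only [ContinuousLinearMap.comp_apply, smul_apply, innerSL_apply_apply,
      smul_eq_mul]
    rw [real_inner_comm, primitiveOp_tens hs, inner_L2 (tens_coeFn _) (testDeriv_coeFn S φ),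
      real_inner_comm, inner_L2 (partialPrimitiveOp_tens hs S) (testDeriv_empty_coeFn φ),
      integral_box_tensFun_mul_mixedDeriv S (fun j => contDiff_primitive (hs j) _) φ]
    simp only [fun j => funext fun t => (hasDerivAt_primitive (hs j).continuous (a j) t).deriv]
  have h := congrArg (fun A => A v) key
  simp only [ContinuousLinearMap.comp_apply, smul_apply, innerSL_apply_apply,
    smul_eq_mul] at h
  rwa [real_inner_comm, inner_L2 (Filter.EventuallyEq.refl _ _) (testDeriv_coeFn S φ),
    real_inner_comm, inner_L2 (Filter.EventuallyEq.refl _ _) (testDeriv_empty_coeFn φ)] at h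

/-- `T` as a linear map into `M^{n,2}(Ω)`. -/
def primitiveLin {n : ℕ} (a b : Fin n → ℝ) : L2 a b →ₗ[ℝ] M a b :=
  LinearMap.codRestrict (mixedSubmodule a b) (primitiveOp a b).toLinearMap fun v S =>
    ⟨_, hasWeakMixedDeriv_primitiveOp S v⟩

theorem toL2_primitiveLin {n : ℕ} {a b : Fin n → ℝ} (v : L2 a b) :
    M.toL2 (primitiveLin a b v) = primitiveOp a b v := rfl

theorem weakDeriv_primitiveLin {n : ℕ} {a b : Fin n → ℝ} (S : Finset (Fin n)) (v : L2 a b) :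
    weakDeriv S (primitiveLin a b v) = partialPrimitiveOp a b S v :=
  (weakDeriv_spec S _).unique (hasWeakMixedDeriv_primitiveOp S v)

theorem weakDeriv_univ_primitiveLin {n : ℕ} {a b : Fin n → ℝ} (v : L2 a b) :
    weakDeriv Finset.univ (primitiveLin a b v) = v := by
  rw [weakDeriv_primitiveLin, partialPrimitiveOp_univ]

theorem continuous_primitiveLin {n : ℕ} (a b : Fin n → ℝ) : Continuous (primitiveLin a b) := by
  refine AddMonoidHomClass.continuous_of_bound (primitiveLin a b)
    (Real.sqrt (∑ S : Finset (Fin n), ‖partialPrimitiveOp a b S‖ ^ 2)) fun v => ?_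
  rw [norm_M_eq, ← Real.sqrt_sq (norm_nonneg v), ← Real.sqrt_mul (by positivity), Finset.sum_mul]
  refine Real.sqrt_le_sqrt (Finset.sum_le_sum fun S _ => ?_)
  rw [weakDeriv_primitiveLin, ← mul_pow]
  gcongr
  exact ContinuousLinearMap.le_opNorm _ _

theorem continuous_weakDeriv {n : ℕ} {a b : Fin n → ℝ} (S : Finset (Fin n)) :
    Continuous (weakDeriv (a := a) (b := b) S) := by
  refine AddMonoidHomClass.continuous_of_bound (weakDeriv (a := a) (b := b) S) 1 fun u => ?_
  rw [one_mul, norm_M_eq]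
  exact Real.le_sqrt_of_sq_le
    (Finset.single_le_sum (f := fun S => ‖weakDeriv S u‖ ^ 2) (fun _ _ => sq_nonneg _)
      (Finset.mem_univ S))

theorem M.toL2_injective {n : ℕ} {a b : Fin n → ℝ} :
    Function.Injective (M.toL2 (a := a) (b := b)) :=
  Subtype.val_injective

/-! ### Mixed derivatives of test functions -/

theorem kernelOps_singleton {n : ℕ} {a b : Fin n → ℝ} (κ : Fin n → BoundedKernel) (i : Fin n) :
    kernelOps a b κ [i] = kernelOp a b i (κ i) := rfl

/-- Tested against a tensor product, `T` moves over as its adjoint, integration up to the right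
ends. Integrating by parts then restores the original factors: the sign `(-1)^n` cancels against the
one from differentiating in the lower limits. -/
theorem primitiveOp_testDeriv_univ {n : ℕ} {a b : Fin n → ℝ} (φ : 𝓓(box a b, ℝ)) :
    primitiveOp a b (testDeriv Finset.univ φ) = testDeriv ∅ φ := by
  refine L2.ext_inner_tens fun g hg => ?_
  have hs : ∀ j, ContDiff ℝ ∞ (g j) := fun j => (hg j).contDiff
  have hH : ∀ j, ContDiff ℝ ∞ fun t => ∫ ξ in t..(b j), g j ξ := fun j => by
    simp only [intervalIntegral.integral_symm (b j)]
    exact (contDiff_primitive (hs j) _).neg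
  have hd : ∀ j, deriv (fun t => ∫ ξ in t..(b j), g j ξ) = fun t => - g j t := fun j => by
    simp only [intervalIntegral.integral_symm (b j)]
    exact funext fun t => (hasDerivAt_primitive (hs j).continuous (b j) t).neg.deriv
  have e : kernelOps a b (fun _ => leftKernel.transpose) (List.finRange n)
      (tens g (IsTest.memLp hg)) =ᵐ[boxMeasure a b] tensFun fun j t => ∫ ξ in t..(b j), g j ξ := by
    rw [kernelOps_tens _ (List.nodup_finRange n)]
    refine (tens_coeFn _).trans ?_
    filter_upwards [mem_box_ae a b] with x hx
    refine Finset.prod_congr rfl fun j _ => ?_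
    simpa [kernelFuns₁] using kernelFun₁_left_transpose (g j) (hx j (Set.mem_univ j))
  rw [← ContinuousLinearMap.adjoint_inner_right, primitiveOp,
    adjoint_kernelOps a b _ (List.nodup_finRange n), real_inner_comm,
    inner_L2 e (testDeriv_coeFn _ φ), integral_box_tensFun_mul_mixedDeriv _ hH, real_inner_comm,
    inner_L2 (tens_coeFn _) (testDeriv_empty_coeFn φ), ← integral_const_mul]
  refine integral_congr_ae (ae_of_all _ fun x => ?_)
  simp only [tensFun, Finset.mem_univ, if_true, hd, Finset.prod_neg]
  rw [← mul_assoc, ← mul_assoc, ← mul_pow]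
  simp

/-- The adjoint replaces the `i`-th factor of the tensor product by a constant, which the
integration by parts then differentiates to zero. -/
theorem kernelOp_one_testDeriv_univ {n : ℕ} {a b : Fin n → ℝ} (φ : 𝓓(box a b, ℝ)) (i : Fin n) :
    kernelOp a b i oneKernel (testDeriv Finset.univ φ) = 0 := by
  refine L2.ext_inner_tens fun g hg => ?_
  set c := ∫ ξ, g i ξ ∂sideMeasure a b i
  have hc : ∀ j, ContDiff ℝ ∞ (Function.update g i (fun _ => c) j) := fun j => by
    by_cases hj : j = i
    · subst hj; rw [Function.update_self]; exact contDiff_const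
    · rw [Function.update_of_ne hj]; exact (hg j).contDiff
  have e : kernelOps a b (fun _ => oneKernel.transpose) [i] (tens g (IsTest.memLp hg))
      =ᵐ[boxMeasure a b] tensFun (Function.update g i fun _ => c) := by
    rw [kernelOps_tens _ (List.nodup_singleton i)]
    refine (tens_coeFn _).trans (Filter.EventuallyEq.of_eq (congrArg tensFun ?_))
    funext j
    by_cases hj : j = i
    · subst hj
      funext t
      simp [kernelFuns₁, kernelFun₁, oneKernel, fullKernel, BoundedKernel.transpose, c]
    · simp [kernelFuns₁, hj]
  rw [← kernelOps_singleton (fun _ => oneKernel), ← ContinuousLinearMap.adjoint_inner_right,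
    adjoint_kernelOps a b _ (List.nodup_singleton i), real_inner_comm,
    inner_L2 e (testDeriv_coeFn _ φ), integral_box_tensFun_mul_mixedDeriv _ hc, inner_zero_left]
  have h0 : ∀ x, tensFun (fun j => if j ∈ Finset.univ then
      deriv (Function.update g i (fun _ => c) j) else Function.update g i (fun _ => c) j) x = 0 :=
    fun x => Finset.prod_eq_zero (Finset.mem_univ i) (by simp)
  simp only [h0, zero_mul, integral_zero, mul_zero]

/-- Both assertions are closed conditions in the norm of `M^{n,2}(Ω)`, as `T`, `D^{(1, …, 1)}` and
the slice integrals are continuous; it suffices to check them on test functions. -/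
theorem zeroSubmodule_spec {n : ℕ} {a b : Fin n → ℝ} {u : M a b} (hu : u ∈ zeroSubmodule a b) :
    primitiveLin a b (weakDeriv Finset.univ u) = u ∧ weakDeriv Finset.univ u ∈ L0 a b := by
  rw [mem_L0_iff]
  have hcl : IsClosed {u : M a b | primitiveLin a b (weakDeriv Finset.univ u) = u ∧
      ∀ i, kernelOp a b i oneKernel (weakDeriv Finset.univ u) = 0} := by
    simp only [Set.ofPred_and, Set.ofPred_forall]
    exact (isClosed_eq ((continuous_primitiveLin a b).comp (continuous_weakDeriv _))
      continuous_id).inter (isClosed_iInter fun i => isClosed_eq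
        ((kernelOp a b i oneKernel).continuous.comp (continuous_weakDeriv _)) continuous_const)
  refine closure_minimal ?_ hcl hu
  rintro u ⟨φ, hφ⟩
  have h1 : primitiveLin a b (testDeriv Finset.univ φ) = u := by
    refine M.toL2_injective ?_
    rw [toL2_primitiveLin, primitiveOp_testDeriv_univ]
    exact Lp.ext ((testDeriv_empty_coeFn φ).trans hφ.symm)
  have h2 : weakDeriv Finset.univ u = testDeriv Finset.univ φ := by
    rw [← h1, weakDeriv_univ_primitiveLin]
  refine ⟨by rw [h2, h1], fun i => ?_⟩
  rw [h2, kernelOp_one_testDeriv_univ]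

/-! ### Approximation in `L₀` -/

/-- The primitive vanishes to the left of the support of `g`, and to its right because the total
integral is zero. -/
theorem IsTest.primitive {α β : ℝ} (hαβ : α < β) {g : ℝ → ℝ} (hg : IsTest α β g)
    (h0 : ∫ t in α..β, g t = 0) : IsTest α β fun t => ∫ ξ in α..t, g ξ := by
  -- The point `m` keeps the compact set nonempty when `g = 0`, so that it has a least and a
  -- greatest element.
  obtain ⟨m, hm⟩ := exists_between hαβ
  have hK : IsCompact (insert m (tsupport g)) := hg.hasCompactSupport.isCompact.insert m
  have hKs : insert m (tsupport g) ⊆ Set.Ioo α β := Set.insert_subset hm hg.tsupport_subset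
  obtain ⟨c, hcK, hc⟩ := hK.exists_isLeast (Set.insert_nonempty _ _)
  obtain ⟨d, hdK, hd⟩ := hK.exists_isGreatest (Set.insert_nonempty _ _)
  have hz : ∀ ξ, ξ ∉ Set.Icc c d → g ξ = 0 := fun ξ hξ =>
    image_eq_zero_of_notMem_tsupport fun h =>
      hξ ⟨hc (Set.mem_insert_of_mem _ h), hd (Set.mem_insert_of_mem _ h)⟩
  have hint : ∀ p q, IntervalIntegrable g volume p q := fun p q =>
    hg.contDiff.continuous.intervalIntegrable p q
  have hsub : tsupport (fun t => ∫ ξ in α..t, g ξ) ⊆ Set.Icc c d := by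
    refine closure_minimal (fun t ht => ?_) isClosed_Icc
    by_contra hn
    refine ht ?_
    rcases not_and_or.1 hn with h | h
    · refine (intervalIntegral.integral_congr fun ξ hξ => hz ξ fun h' => ?_).trans
        intervalIntegral.integral_zero
      have := (Set.mem_uIcc.1 hξ)
      rcases this with h1 | h1 <;> linarith [h'.1, h1.1, h1.2, (hKs hcK).1]
    · change ∫ ξ in α..t, g ξ = 0
      rw [← intervalIntegral.integral_add_adjacent_intervals (hint α β) (hint β t), h0, zero_add]
      refine (intervalIntegral.integral_congr fun ξ hξ => hz ξ fun h' => ?_).trans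
        intervalIntegral.integral_zero
      have := (Set.mem_uIcc.1 hξ)
      rcases this with h1 | h1 <;> linarith [h'.2, h1.1, h1.2, (hKs hdK).2]
  exact ⟨contDiff_primitive hg.contDiff α,
    HasCompactSupport.of_support_subset_isCompact isCompact_Icc (subset_closure.trans hsub),
    hsub.trans fun t ht => ⟨(hKs hcK).1.trans_le ht.1, ht.2.trans_lt (hKs hdK).2⟩⟩

theorem IsTest.sub_const_mul {α β : ℝ} {g ρ : ℝ → ℝ} (hg : IsTest α β g) (hρ : IsTest α β ρ)
    (c : ℝ) : IsTest α β fun t => g t - ρ t * c := by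
  have hsub : tsupport (fun t => g t - ρ t * c) ⊆ tsupport g ∪ tsupport ρ := by
    refine closure_minimal (fun t ht => ?_) ((isClosed_tsupport _).union (isClosed_tsupport _))
    by_contra hn
    rw [Set.mem_union, not_or] at hn
    refine ht ?_
    simp [image_eq_zero_of_notMem_tsupport hn.1, image_eq_zero_of_notMem_tsupport hn.2]
  exact ⟨hg.contDiff.sub (hρ.contDiff.mul contDiff_const),
    HasCompactSupport.of_support_subset_isCompact (hg.hasCompactSupport.isCompact.union
      hρ.hasCompactSupport.isCompact) (subset_closure.trans hsub),
    hsub.trans (Set.union_subset hg.tsupport_subset hρ.tsupport_subset)⟩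

theorem exists_isTest_integral_eq_one {α β : ℝ} (h : α < β) :
    ∃ ρ : ℝ → ℝ, IsTest α β ρ ∧ ∫ t in α..β, ρ t = 1 := by
  let B : ContDiffBump ((α + β) / 2) := ⟨(β - α) / 8, (β - α) / 4, by linarith, by linarith⟩
  have hs : tsupport (B.normed volume) ⊆ Set.Ioo α β := by
    rw [B.tsupport_normed_eq, Real.closedBall_eq_Icc]
    exact Set.Icc_subset_Ioo (by simp only [B]; linarith) (by simp only [B]; linarith)
  refine ⟨B.normed volume, ⟨B.contDiff_normed, B.hasCompactSupport_normed, hs⟩, ?_⟩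
  rw [intervalIntegral.integral_of_le h.le, integral_Ioc_eq_integral_Ioo,
    setIntegral_eq_integral_of_forall_compl_eq_zero
      fun t ht => image_eq_zero_of_notMem_tsupport fun h' => ht (hs h'), B.integral_normed]

theorem IsTest.exists_norm_le {α β : ℝ} {g : ℝ → ℝ} (hg : IsTest α β g) :
    ∃ C, ∀ t, ‖g t‖ ≤ C :=
  hg.hasCompactSupport.exists_bound_of_continuous hg.contDiff.continuous

/-- The composition, along a list of coordinates, of the operators `1 - K_i`, where `K_i` has the
kernel `κ i` in the `i`-th coordinate. -/
def complOps {n : ℕ} (a b : Fin n → ℝ) (κ : Fin n → BoundedKernel) (l : List (Fin n)) :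
    L2 a b →L[ℝ] L2 a b :=
  l.foldr (fun i A => (ContinuousLinearMap.id ℝ _ - kernelOp a b i (κ i)) ∘L A)
    (ContinuousLinearMap.id ℝ _)

theorem complOps_cons {n : ℕ} {a b : Fin n → ℝ} (κ : Fin n → BoundedKernel) (i : Fin n)
    (l : List (Fin n)) (v : L2 a b) :
    complOps a b κ (i :: l) v =
      complOps a b κ l v - kernelOp a b i (κ i) (complOps a b κ l v) := rfl

theorem complOps_eq_self {n : ℕ} {a b : Fin n → ℝ} (κ : Fin n → BoundedKernel)
    (l : List (Fin n)) {v : L2 a b} (hv : ∀ i, kernelOp a b i (κ i) v = 0) :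
    complOps a b κ l v = v := by
  induction l with
  | nil => rfl
  | cons i l ih => rw [complOps_cons, ih, hv, sub_zero]

/-- A difference of two tensor products that differ only in the `i`-th factor is again a tensor
product, so each `1 - K_i` acts on the `i`-th factor alone. -/
theorem complOps_tens {n : ℕ} {a b : Fin n → ℝ} (κ : Fin n → BoundedKernel)
    {l : List (Fin n)} (hl : l.Nodup) {h : Fin n → ℝ → ℝ}
    (hh : ∀ j, MemLp (h j) 2 (sideMeasure a b j)) :
    complOps a b κ l (tens h hh) =ᵐ[boxMeasure a b]
      tensFun fun j => if j ∈ l then fun t => h j t - kernelFun₁ a b j (κ j) (h j) t else h j := by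
  induction l with
  | nil => simpa [complOps] using tens_coeFn hh
  | cons i l ih =>
    obtain ⟨hi, hl⟩ := List.nodup_cons.1 hl
    rw [complOps_cons]
    filter_upwards [Lp.coeFn_sub (complOps a b κ l (tens h hh))
      (kernelOp a b i (κ i) (complOps a b κ l (tens h hh))), ih hl,
      kernelOp_coeFn i (κ i) (ih hl)] with x h1 h2 h3
    set P : Fin n → ℝ → ℝ := fun j =>
      if j ∈ l then fun t => h j t - kernelFun₁ a b j (κ j) (h j) t else h j
    have hP : P i = h i := by simp [P, hi]
    have e : (fun j => if j ∈ i :: l then fun t => h j t - kernelFun₁ a b j (κ j) (h j) t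
        else h j) = Function.update P i fun t => h i t - kernelFun₁ a b i (κ i) (h i) t := by
      funext j
      by_cases hj : j = i
      · subst hj; simp
      · simp [P, hj]
    have hu : ∀ g : ℝ → ℝ, tensFun (Function.update P i g) x =
        g (x i) * ∏ j ∈ Finset.univ.erase i, P j (x j) := fun g => by
      rw [← tensFun_update, Function.update_eq_self]
    have h0 := hu (P i)
    rw [Function.update_eq_self] at h0
    rw [h1, Pi.sub_apply, h2, h3, kernelFun_tensFun, e, hu, hu, h0, hP, sub_mul]

/-- The tensor product of test functions of one variable as a test function on the box. -/
def tensTest {n : ℕ} {a b : Fin n → ℝ} (h : Fin n → ℝ → ℝ)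
    (hh : ∀ j, IsTest (a j) (b j) (h j)) : 𝓓(box a b, ℝ) :=
  have hsub : tsupport (tensFun h) ⊆ Set.univ.pi fun j => tsupport (h j) :=
    closure_minimal (fun _ hx j _ => subset_closure (Finset.prod_ne_zero_iff.1 hx j
      (Finset.mem_univ j))) (isClosed_set_pi fun _ _ => isClosed_tsupport _)
  ⟨tensFun h, contDiff_tensFun fun j => (hh j).contDiff,
    HasCompactSupport.of_support_subset_isCompact
      (isCompact_univ_pi fun j => (hh j).hasCompactSupport.isCompact)
      (subset_closure.trans hsub),
    hsub.trans (Set.pi_mono fun j _ => (hh j).tsupport_subset)⟩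

theorem primitiveLin_mem_zeroSubmodule {n : ℕ} {a b : Fin n → ℝ} (hab : ∀ i, a i < b i)
    {v : L2 a b} (hv : v ∈ L0 a b) : primitiveLin a b v ∈ zeroSubmodule a b := by
  choose ρ hρ hρ1 using fun i => exists_isTest_integral_eq_one (hab i)
  choose C hC using fun i => (hρ i).exists_norm_le
  set κ : Fin n → BoundedKernel := fun i =>
    fullKernel (ρ i) (hρ i).contDiff.continuous (C i) (hC i)
  -- Here `K_i v = ρ_i S_i v`, which vanishes for `v ∈ L₀`.
  have hvQ : complOps a b κ (List.finRange n) v = v := by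
    refine complOps_eq_self κ _ fun i => ?_
    have h0 := Lp.eq_zero_iff_ae_eq_zero.1 ((mem_L0_iff v).1 hv i)
    rw [Lp.eq_zero_iff_ae_eq_zero]
    filter_upwards [h0, kernelOp_coeFn i oneKernel (Filter.EventuallyEq.refl _ v),
      kernelOp_coeFn i (κ i) (Filter.EventuallyEq.refl _ v)] with x h0 h1 h2
    rw [h1] at h0
    rw [h2]
    simp only [kernelFun, oneKernel, fullKernel, Pi.one_apply, one_mul, κ] at h0 ⊢
    rw [integral_const_mul, h0, Pi.zero_apply, mul_zero]
  rw [← hvQ]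
  -- Continuity of `T` into the full norm of `M^{n,2}(Ω)` is what is used here, since `M₀^{n,2}(Ω)`
  -- is a closure in that norm.
  have hcl : IsClosed ((zeroSubmodule a b).comap
      (primitiveLin a b ∘ₗ (complOps a b κ (List.finRange n)).toLinearMap) : Set (L2 a b)) :=
    (Submodule.isClosed_topologicalClosure _).preimage
      ((continuous_primitiveLin a b).comp (complOps a b κ (List.finRange n)).continuous)
  have hspan : Submodule.span ℝ (testTensors a b) ≤ (zeroSubmodule a b).comap
      (primitiveLin a b ∘ₗ (complOps a b κ (List.finRange n)).toLinearMap) := by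
    refine Submodule.span_le.2 ?_
    rintro - ⟨g, hg, rfl⟩
    refine Submodule.le_topologicalClosure _ ?_
    -- These are the factors after applying `1 - K_j`; they have mean zero because `ρ j` has
    -- integral one.
    set q : Fin n → ℝ → ℝ := fun j t => g j t - ρ j t * ∫ ξ in (a j)..(b j), g j ξ
    have hq : ∀ j, IsTest (a j) (b j) (q j) := fun j => (hg j).sub_const_mul (hρ j) _
    have hq0 : ∀ j, ∫ t in (a j)..(b j), q j t = 0 := fun j => by
      simp only [q]
      rw [intervalIntegral.integral_sub ((hg j).contDiff.continuous.intervalIntegrable _ _)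
        (((hρ j).contDiff.continuous.intervalIntegrable _ _).mul_const _),
        intervalIntegral.integral_mul_const, hρ1, one_mul, sub_self]
    have hQ : complOps a b κ (List.finRange n) (tens g (IsTest.memLp hg)) =
        tens q fun j => memLp_of_continuous (hq j).contDiff.continuous := by
      refine Lp.ext ((complOps_tens κ (List.nodup_finRange n) _).trans
        (Filter.EventuallyEq.trans (Filter.EventuallyEq.of_eq (congrArg tensFun ?_))
          (tens_coeFn _).symm))
      funext j t
      simp [kernelFun₁, κ, fullKernel, q, integral_const_mul,
        intervalIntegral.integral_of_le (hab j).le, integral_Ioc_eq_integral_Ioo]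
    refine ⟨tensTest _ fun j => (hq j).primitive (hab j) (hq0 j), ?_⟩
    rw [LinearMap.comp_apply, toL2_primitiveLin, ContinuousLinearMap.coe_coe, hQ,
      primitiveOp_tens fun j => (hq j).contDiff]
    exact tens_coeFn _
  exact (closure_minimal hspan hcl) (dense_span_testTensors a b v)

/-! ### The isometric isomorphism and its inverse -/

/-- `T` as a linear map from `L₀` to `M₀^{n,2}(Ω)`. -/
def primitiveL0 {n : ℕ} {a b : Fin n → ℝ} (hab : ∀ i, a i < b i) : L0 a b →ₗ[ℝ] M0 a b :=
  LinearMap.codRestrict (zeroSubmodule a b) (primitiveLin a b ∘ₗ (L0 a b).subtype)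
    fun v => primitiveLin_mem_zeroSubmodule hab v.2

/-- `D^{(1, …, 1)}` as a linear map from `M₀^{n,2}(Ω)` to `L₀`. -/
def fullDerivL0 {n : ℕ} {a b : Fin n → ℝ} : M0 a b →ₗ[ℝ] L0 a b :=
  LinearMap.codRestrict (L0 a b) fullDeriv fun u => (zeroSubmodule_spec u.2).2

theorem fullDeriv_primitiveL0 {n : ℕ} {a b : Fin n → ℝ} (hab : ∀ i, a i < b i) (v : L0 a b) :
    fullDeriv (primitiveL0 hab v) = (v : L2 a b) :=
  weakDeriv_univ_primitiveLin (v : L2 a b)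

theorem primitiveL0_fullDerivL0 {n : ℕ} {a b : Fin n → ℝ} (hab : ∀ i, a i < b i) (u : M0 a b) :
    primitiveL0 hab (fullDerivL0 u) = u :=
  Subtype.ext (zeroSubmodule_spec u.2).1

/-- `T`, as an isometric isomorphism from `L₀` onto `M₀^{n,2}(Ω)`. -/
def primitiveEquiv {n : ℕ} {a b : Fin n → ℝ} (hab : ∀ i, a i < b i) : L0 a b ≃ₗᵢ[ℝ] M0 a b where
  toLinearEquiv := LinearEquiv.ofLinearMap (primitiveL0 hab) fullDerivL0
    (LinearMap.ext (primitiveL0_fullDerivL0 hab))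
    (LinearMap.ext fun v => Subtype.ext (fullDeriv_primitiveL0 hab v))
  norm_map' v := by
    rw [LinearEquiv.coe_ofLinearMap, norm_M0_eq, fullDeriv_primitiveL0, Submodule.coe_norm]

end MixedSob

end

theorem mainTheorem2 {n : ℕ} (a b : Fin n → ℝ) (hab : ∀ i, a i < b i) :
    (∀ u : MixedSob.M0 a b, ‖u‖ = 0 → u = 0) ∧
    ∃ e : MixedSob.L0 a b ≃ₗᵢ[ℝ] MixedSob.M0 a b,
      (∀ (v : MixedSob.L0 a b) (f : (Fin n → ℝ) → ℝ),
        f =ᵐ[MixedSob.boxMeasure a b] (v : MixedSob.L2 a b) →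
          MixedSob.M0.toL2 (e v) =ᵐ[MixedSob.boxMeasure a b] MixedSob.iteratedPrimitive a f) ∧
      ∀ u : MixedSob.M0 a b, (e.symm u : MixedSob.L2 a b) = MixedSob.fullDeriv u := by
  refine ⟨fun u hu => ?_, MixedSob.primitiveEquiv hab,
    fun v f hf => MixedSob.primitiveOp_coeFn (v : MixedSob.L2 a b) hf, fun u => rfl⟩
  -- The inverse preserves the seminorm and takes values in `L₀`, where the norm is definite.
  have h : (MixedSob.primitiveEquiv hab).symm u = 0 := by
    rw [← norm_eq_zero, LinearIsometryEquiv.norm_map, hu]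
  simpa using congrArg (MixedSob.primitiveEquiv hab) h
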